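/- **Setting.** Let $n\ge 1$, $k\ge 1$, let $\mathfrak g$ be the simple complex Lie algebra of type $C_n$ with roots $\pm\varepsilon_i\pm\varepsilon_j$, let $\langle\,,\rangle$ be the invariant form with $\langle\theta,\theta\rangle=2$ for $\theta=2\varepsilon_1$, and let $\hat{\mathfrak g}=\mathfrak g\otimes\mathbb C[t,t^{-1}]\oplus\mathbb Cc$ be the affine Lie algebra of type $C_n^{(1)}$, $[x(i),y(j)]=[x,y](i+j)+i\,\delta_{i+j,0}\langle x,y\rangle c$. Order the indices by $1\succ 2\succ\dots\succ n\succ\underline n\succ\dots\succ\underline 1$ and put $\varepsilon_{\underline i}=-\varepsilon_i$. Fix a triangular basis $X_{ab}$ of $\mathfrak g$ (column $a$, row $b$, $a\succeq b$): for $b\ne\underline a$ (where $\underline{\underline i}=i$), $X_{ab}=X_\alpha$ is a root vector for $\alpha=\varepsilon_a+\varepsilon_b$, with $[X_\alpha,X_{-\alpha}]=\alpha^\vee$, and $X_{i\underline i}=\alpha_i^\vee$ for the simple roots $\alpha_i=\varepsilon_i-\varepsilon_{i+1}$ ($i<n$), $\alpha_n=2\varepsilon_n$. Order it by: $X_{ab}\succ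 X_{a'b'}$ iff $b\succ b'$, or $b=b'$ and $a\succ a'$. Order the symbols $X_{ab}(j)$, $j\in\mathbb Z$, by $j$ first and then by $X_{ab}$. A colored partition $\Pi$ is a finite multiset of symbols $X_{ab}(j)$; its length is the number of its parts, its degree the sum of their degrees $j$, its shape the multiset of their degrees. For $\Pi=\{X_1(j_1)\preceq\dots\preceq X_\ell(j_\ell)\}$ let $X(\Pi)=X_1(j_1)\cdots X_\ell(j_\ell)$ in $\mathcal U=U(\hat{\mathfrak g})/(c-k)$. Put $\Pi\prec\Phi$ if $\Pi$ is longer; or has the same length and smaller degree; or, these being equal, has smaller shape in the reverse lexicographical order (compare from the largest part down); or, the shapes being equal too, has smaller colors in the reverse lexicographical order. Complete $\mathcal U$ in the topology given by the left ideals generated by all $x(i)$ with $x\in\mathfrak g$, $i\ge N$ ($N\ge 0$). An element $\rho$ of the completion has leading term $\Phi$ if $\rho=c_\Phi X(\Phi)+\sum_{\Psi\succ\Phi}c_\Psi X(\Psi)$ is a convergent, possibly infinite, sum with $c_\Phi\neq0$. Let $N(k\Lambda_0)$ be the universal level $k$ affine vertex algebra of $\hat{\mathfrak g}$, with vacuum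 vector $\mathbf 1$ and vertex operators $Y(v,z)=\sum_{m\in\mathbb Z} v_mz^{-m-1}$, whose coefficients $v_m$ are regarded as elements of the completion of $\mathcal U$. Let $R=U(\mathfrak g)X_{11}(-1)^{k+1}\mathbf 1$ and $\bar R=\operatorname{span}_{\mathbb C}\{r_m\mid r\in R,\,m\in\mathbb Z\}$; the elements $r_m$ are the relations for level $k$ standard modules. A cascade is a finite (possibly empty) sequence $(X_{a_1b_1},\dots,X_{a_sb_s})$ of basis elements such that, for each $i<s$, either $a_{i+1}=a_i$ and $b_{i+1}\prec b_i$, or $b_{i+1}=b_i$ and $a_{i+1}\succ a_i$. A cascade with multiplicities has a multiplicity $m\in\mathbb Z_{\ge0}$ at each of its places. For an index $r$ let $\triangle_r=\{X_{ab}\mid b\succeq r\}$ (rows $1,\dots,r$) and ${}^r\!\triangle=\{X_{ab}\mid a\preceq r\}$ (columns $r,\dots,\underline 1$). **Theorem.** Let $j\in\mathbb Z$, let $a,b\ge 0$ be integers with $a+b=k+1$, and let $r\in\{1,\dots,n,\underline n,\dots,\underline 1\}$. Let $\mathcal B$ be a cascade with multiplicities $(m_\beta)$ with $\sum_{\beta\in\mathcal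 B}m_\beta=b$ and $\mathcal A$ a cascade with multiplicities $(m_\alpha)$ with $\sum_{\alpha\in\mathcal A}m_\alpha=a$, such that every place of $\mathcal B$ with nonzero multiplicity lies in $\triangle_r$ and every place of $\mathcal A$ with nonzero multiplicity lies in ${}^r\!\triangle$. Then the colored partition $$\prod_{\beta\in\mathcal B}X_\beta(-j-1)^{m_\beta}\ \prod_{\alpha\in\mathcal A}X_\alpha(-j)^{m_\alpha}$$ is the leading term of some relation $r_m\in\bar R$, with $r_m$ a coefficient of an annihilating field $Y(r,z)$, $r\in R$. -/

import Mathlib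

noncomputable section

namespace AffineC

attribute [local instance 100] LieRing.ofAssociativeRing

/-! ### The simple Lie algebra of type `C_n`, its root vectors and its triangular basis -/

/-- The simple complex Lie algebra of type `C_n`. -/
abbrev SpAlg (n : ℕ) : Type := LieAlgebra.Symplectic.sp (Fin n) ℂ

/-- The set of indices `{1, …, n, n̲, …, 1̲}`; here `1, …, n` are numbered from `0`, so that
`plain i` is the index `i + 1` and `under i` is the underlined index `i + 1`. -/
inductive Idx (n : ℕ) : Type
  | plain (i : Fin n) : Idx n
  | under (i : Fin n) : Idx n

/-- The position of an index in the list `1, 2, …, n, n̲, …, 2̲, 1̲` (counted from `0`). -/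
def Idx.pos {n : ℕ} : Idx n → ℕ
  | .plain i => i
  | .under i => 2 * n - 1 - i

theorem Idx.pos_injective {n : ℕ} : Function.Injective (Idx.pos (n := n)) := by
  rintro (i | i) (j | j) h <;> simp only [Idx.pos] at h
  · congr 1; omega
  · omega
  · omega
  · congr 1; omega

/-- The order `1 ≻ 2 ≻ ⋯ ≻ n ≻ n̲ ≻ ⋯ ≻ 2̲ ≻ 1̲`. -/
instance (n : ℕ) : LinearOrder (Idx n) :=
  LinearOrder.lift' (fun a : Idx n => OrderDual.toDual a.pos)
    (OrderDual.toDual.injective.comp Idx.pos_injective)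

theorem Idx.le_iff {n : ℕ} {a b : Idx n} : a ≤ b ↔ b.pos ≤ a.pos := Iff.rfl

/-- The involution `i ↔ i̲` of the set of indices. -/
def Idx.bar {n : ℕ} : Idx n → Idx n
  | .plain i => .under i
  | .under i => .plain i

theorem Idx.bar_le_bar {n : ℕ} {a b : Idx n} (h : a ≤ b) : b.bar ≤ a.bar := by
  rw [Idx.le_iff] at *
  rcases a with i | i <;> rcases b with j | j <;> simp only [Idx.pos, Idx.bar] at * <;> omega

/-- The coordinate vector of `ε_a`, where `ε_{i̲} = -ε_i`. -/
def Idx.eps {n : ℕ} : Idx n → (Fin n → ℂ)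
  | .plain i => Pi.single i 1
  | .under i => -Pi.single i 1

/-- The value of the functional `ε_a` at the element of the Cartan subalgebra with
coordinates `h`, where `ε_{i̲} = -ε_i`. -/
def Idx.weight {n : ℕ} (h : Fin n → ℂ) : Idx n → ℂ
  | .plain i => h i
  | .under i => -h i

/-- The places `ab` of the triangular basis: column `a`, row `b`, with `a ∈ {1, …, b}`. -/
@[ext]
structure Place (n : ℕ) : Type where
  /-- the column `a` -/
  col : Idx n
  /-- the row `b` -/
  row : Idx n
  row_le_col : row ≤ col

/-- `ab ≻ a'b'` iff `b ≻ b'`, or `b = b'` and `a ≻ a'`. -/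
instance (n : ℕ) : LinearOrder (Place n) :=
  LinearOrder.lift' (fun p : Place n => toLex (p.row, p.col)) (by
    intro p q h
    have h' : (p.row, p.col) = (q.row, q.col) := toLex.injective h
    rw [Prod.mk.injEq] at h'
    exact Place.ext h'.2 h'.1)

/-- The place of the weight opposite to that of `ab`. -/
def Place.neg {n : ℕ} (p : Place n) : Place n :=
  ⟨p.row.bar, p.col.bar, Idx.bar_le_bar p.row_le_col⟩

/-- The place `i i̲`, of weight zero. -/
def Place.zero {n : ℕ} (i : Fin n) : Place n :=
  ⟨.plain i, .under i, by
    rw [Idx.le_iff]; simp only [Idx.pos]; omega⟩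

/-- The place `11`, of the maximal root `θ = 2 ε_1`. -/
def Place.theta {n : ℕ} (hn : 1 ≤ n) : Place n :=
  ⟨.plain ⟨0, hn⟩, .plain ⟨0, hn⟩, le_rfl⟩

/-- The element `diag(h, -h)` of the diagonal Cartan subalgebra. -/
def cartan {n : ℕ} (h : Fin n → ℂ) : SpAlg n :=
  ⟨Matrix.diagonal (Sum.elim h (-h)), by
    change _ ∈ skewAdjointMatricesLieSubalgebra _
    rw [mem_skewAdjointMatricesLieSubalgebra, mem_skewAdjointMatricesSubmodule]
    simp only [Matrix.IsSkewAdjoint, Matrix.IsAdjointPair, Matrix.diagonal_transpose]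
    ext (i | i) (j | j) <;>
      simp [Matrix.J, Matrix.mul_apply, Matrix.diagonal_apply, Matrix.one_apply,
        Matrix.fromBlocks]
    all_goals
      by_cases hij : i = j
      · subst hij; simp
      · simp [hij]⟩

/-- The dual root `α^∨` of the root `α = ε_a + ε_b` (with `ε_{i̲} = -ε_i`, `b ≠ a̲`). -/
def coroot {n : ℕ} (p : Place n) : SpAlg n :=
  if p.col = p.row then cartan p.col.eps else cartan (p.col.eps + p.row.eps)

/-- The simple dual roots, for `α_i = ε_i - ε_{i+1}`, `i < n`, and `α_n = 2 ε_n`. -/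
def simpleCoroot {n : ℕ} (i : Fin n) : SpAlg n :=
  if h : i.val + 1 < n then cartan (Pi.single i 1 - Pi.single ⟨i.val + 1, h⟩ 1)
  else cartan (Pi.single i 1)

/-- `X` is a choice of the basis `B = (X_{ab})`: whenever `b ≠ a̲`, the vector `X_{ab}` is a
root vector for the root `α = ε_a + ε_b`, normalized by `[X_α, X_{-α}] = α^∨`; and
`X_{i i̲} = α_i^∨`. -/
structure IsTriangularBasis {n : ℕ} (X : Place n → SpAlg n) : Prop where
  root_vector : ∀ p : Place n, p.row ≠ p.col.bar → ∀ h : Fin n → ℂ,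
    ⁅cartan h, X p⁆ = (p.col.weight h + p.row.weight h) • X p
  lie_neg : ∀ p : Place n, p.row ≠ p.col.bar → ⁅X p, X p.neg⁆ = coroot p
  zero_weight : ∀ i : Fin n, X (Place.zero i) = simpleCoroot i

/-! ### The affine Lie algebra and the level `k` enveloping algebra -/

/-- The invariant form `⟨x, y⟩ = tr (x y)`. It is normalized by `⟨θ, θ⟩ = 2`: indeed `θ^∨` is
`diag(1, 0, …, 0, -1, 0, …, 0)` and `⟨θ^∨, θ^∨⟩ = 2`. -/
def form (n : ℕ) : LinearMap.BilinForm ℂ (SpAlg n) :=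
  LinearMap.mk₂ ℂ (fun x y => Matrix.trace (x.val * y.val))
    (by intro x y z; simp [add_mul]) (by intro c x y; simp)
    (by intro x y z; simp [mul_add]) (by intro c x y; simp)

theorem form_apply {n : ℕ} (x y : SpAlg n) : form n x y = Matrix.trace (x.val * y.val) := rfl

theorem neg_form_isSymm (n : ℕ) : (-form n).IsSymm :=
  ⟨fun x y => congrArg Neg.neg (Matrix.trace_mul_comm x.val y.val)⟩

theorem neg_form_lieInvariant (n : ℕ) : (-form n).lieInvariant (SpAlg n) := by
  intro x y z
  have h1 : (⁅x, y⁆ : SpAlg n).val = x.val * y.val - y.val * x.val := rfl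
  have h2 : (⁅x, z⁆ : SpAlg n).val = x.val * z.val - z.val * x.val := rfl
  simp only [LinearMap.neg_apply, form_apply, h1, h2, sub_mul, mul_sub, Matrix.trace_sub]
  rw [Matrix.mul_assoc y.val x.val z.val, Matrix.mul_assoc x.val y.val z.val,
    Matrix.trace_mul_comm x.val (y.val * z.val), Matrix.mul_assoc y.val z.val x.val]
  ring

/-- The affine Lie algebra `ĝ = g ⊗ ℂ[t, t⁻¹] ⊕ ℂ c`. The cocycle that Mathlib attaches to a
form `Φ` is `(x t^i, y t^j) ↦ j δ_{i+j,0} Φ(x, y)`, so that `Φ = -⟨ , ⟩` gives the usual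
`i δ_{i+j,0} ⟨x, y⟩`. -/
abbrev Affine (n : ℕ) : Type :=
  LieAlgebra.ofTwoCocycle
    (LieAlgebra.LoopAlgebra.twoCocycleOfBilinear ℂ ℤ (SpAlg n) (-form n)
      (neg_form_lieInvariant n) (neg_form_isSymm n))

/-- The linear embedding of `g ⊗ ℂ[t, t⁻¹]` into `ĝ`. -/
def Affine.ofLoop (n : ℕ) : LieAlgebra.loopAlgebra ℂ ℤ (SpAlg n) →ₗ[ℂ] Affine n where
  toFun l := LieAlgebra.ofProd _ (l, 0)
  map_add' l l' := by rw [← LieAlgebra.of_add, Prod.mk_add_mk, add_zero]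
  map_smul' c l := by rw [RingHom.id_apply, ← LieAlgebra.of_smul, Prod.smul_mk, smul_zero]

/-- The element `x(i) = x ⊗ t^i` of `ĝ`. -/
def Affine.of {n : ℕ} (x : SpAlg n) (i : ℤ) : Affine n :=
  Affine.ofLoop n (TensorProduct.tmul ℂ (AddMonoidAlgebra.single i (1 : ℂ)) x)

/-- The canonical central element `c` of `ĝ`. -/
def Affine.c (n : ℕ) : Affine n :=
  LieAlgebra.ofProd _ (0, (TrivialLieModule.equiv ℂ _ ℂ).symm 1)

theorem residuePairing_of {n : ℕ} (x y : SpAlg n) (i j : ℤ) :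
    LieAlgebra.LoopAlgebra.residuePairing ℂ ℤ (SpAlg n) (-form n)
      (TensorProduct.tmul ℂ (AddMonoidAlgebra.single i (1 : ℂ)) x)
      (TensorProduct.tmul ℂ (AddMonoidAlgebra.single j (1 : ℂ)) y) =
      if i + j = 0 then (i : ℂ) * form n x y else 0 := by
  simp only [LieAlgebra.LoopAlgebra.residuePairing_apply_apply,
    LieAlgebra.LoopAlgebra.toFinsupp_single_tmul]
  rw [Finsupp.sum_single_index (by simp)]
  by_cases h : i + j = 0
  · obtain rfl : j = -i := by omega
    simp
  · have h' : i ≠ -j := by omega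
    rw [if_neg h, Finsupp.single_apply, if_neg h']
    simp

theorem Affine.lie_of {n : ℕ} (x y : SpAlg n) (i j : ℤ) :
    ⁅Affine.of x i, Affine.of y j⁆ =
      Affine.of ⁅x, y⁆ (i + j) + (if i + j = 0 then (i : ℂ) * form n x y else 0) • Affine.c n := by
  rw [← residuePairing_of, LieAlgebra.bracket_ofTwoCocycle]
  unfold Affine.of Affine.c
  simp only [Affine.ofLoop, LinearMap.coe_mk, AddHom.coe_mk]
  rw [← LieAlgebra.of_smul, ← LieAlgebra.of_add]
  refine Equiv.congr_arg (Prod.ext ?_ ?_)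
  · simp only [Equiv.symm_apply_apply, LieAlgebra.ExtendScalars.bracket_tmul, Prod.smul_mk,
      Prod.mk_add_mk, smul_zero, add_zero, AddMonoidAlgebra.single_mul_single, mul_one]
  · simp only [Equiv.symm_apply_apply, lie_zero, sub_zero, add_zero, Prod.smul_mk, Prod.mk_add_mk,
      zero_add]
    rw [← map_smul, smul_eq_mul, mul_one]
    rfl

/-- The associative algebra `𝒰 = U(ĝ) / (c - k)`. -/
def LevelAlg (n k : ℕ) : Type :=
  RingQuot (fun u v : UniversalEnvelopingAlgebra ℂ (Affine n) =>
    u = UniversalEnvelopingAlgebra.ι ℂ (Affine.c n) ∧ v = algebraMap ℂ _ (k : ℂ))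

instance (n k : ℕ) : Ring (LevelAlg n k) := inferInstanceAs (Ring (RingQuot _))

instance (n k : ℕ) : Algebra ℂ (LevelAlg n k) := inferInstanceAs (Algebra ℂ (RingQuot _))

/-- The projection `U(ĝ) → 𝒰`. -/
def LevelAlg.mk (n k : ℕ) : UniversalEnvelopingAlgebra ℂ (Affine n) →ₐ[ℂ] LevelAlg n k :=
  RingQuot.mkAlgHom ℂ _

theorem LevelAlg.mk_c (n k : ℕ) :
    LevelAlg.mk n k (UniversalEnvelopingAlgebra.ι ℂ (Affine.c n)) = algebraMap ℂ _ (k : ℂ) :=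
  (RingQuot.mkAlgHom_rel ℂ ⟨rfl, rfl⟩).trans (AlgHom.commutes (LevelAlg.mk n k) (k : ℂ))

theorem LevelAlg.mk_surjective (n k : ℕ) : Function.Surjective (LevelAlg.mk n k) :=
  RingQuot.mkAlgHom_surjective ℂ _

/-- The element `x(i)` of `𝒰`. -/
def gen {n : ℕ} (k : ℕ) (x : SpAlg n) (i : ℤ) : LevelAlg n k :=
  LevelAlg.mk n k (UniversalEnvelopingAlgebra.ι ℂ (Affine.of x i))

/-- `[x(i), y(j)] = [x, y](i + j) + i δ_{i+j,0} ⟨x, y⟩ k` in `𝒰`. -/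
theorem gen_comm {n : ℕ} (k : ℕ) (x y : SpAlg n) (i j : ℤ) :
    gen k x i * gen k y j - gen k y j * gen k x i =
      gen k ⁅x, y⁆ (i + j) +
        algebraMap ℂ (LevelAlg n k) ((if i + j = 0 then (i : ℂ) * form n x y else 0) * k) := by
  have h := congrArg (fun u => LevelAlg.mk n k (UniversalEnvelopingAlgebra.ι ℂ u))
    (Affine.lie_of x y i j)
  simp only [LieHom.map_lie, LieRing.of_associative_ring_bracket, map_sub, map_mul, map_add,
    map_smul, LevelAlg.mk_c] at h
  rw [map_mul, ← Algebra.smul_def]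
  exact h

theorem gen_add {n : ℕ} (k : ℕ) (x y : SpAlg n) (i : ℤ) :
    gen k (x + y) i = gen k x i + gen k y i := by
  simp only [gen, Affine.of, TensorProduct.tmul_add, map_add]

theorem gen_smul {n : ℕ} (k : ℕ) (c : ℂ) (x : SpAlg n) (i : ℤ) :
    gen k (c • x) i = c • gen k x i := by
  simp only [gen, Affine.of, TensorProduct.tmul_smul, map_smul]

theorem LevelAlg.mk_mem {n k : ℕ} {S : Subalgebra ℂ (LevelAlg n k)}
    (hS : ∀ x i, gen k x i ∈ S) (u : UniversalEnvelopingAlgebra ℂ (Affine n)) :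
    LevelAlg.mk n k u ∈ S := by
  have h1 : ∀ l, LevelAlg.mk n k (UniversalEnvelopingAlgebra.ι ℂ (Affine.ofLoop n l)) ∈ S := by
    intro l
    induction l using TensorProduct.induction_on with
    | zero => simp only [map_zero]; exact zero_mem _
    | add l l' h h' => simp only [map_add]; exact add_mem h h'
    | tmul f x =>
      induction f using AddMonoidAlgebra.induction_on with
      | of i => exact hS x _
      | add f f' h h' => simp only [TensorProduct.add_tmul, map_add]; exact add_mem h h'
      | smul c f h =>
        rw [← TensorProduct.smul_tmul']
        simp only [map_smul]
        exact S.smul_mem h c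
  have h2 : ∀ y, LevelAlg.mk n k (UniversalEnvelopingAlgebra.ι ℂ y) ∈ S := by
    intro y
    obtain ⟨⟨l, z⟩, rfl⟩ := (LieAlgebra.ofProd _).surjective y
    have hy : LieAlgebra.ofProd (LieAlgebra.LoopAlgebra.twoCocycleOfBilinear ℂ ℤ (SpAlg n)
        (-form n) (neg_form_lieInvariant n) (neg_form_isSymm n)) (l, z) =
        Affine.ofLoop n l + (TrivialLieModule.equiv ℂ _ ℂ z) • Affine.c n := by
      simp only [Affine.ofLoop, Affine.c, LinearMap.coe_mk, AddHom.coe_mk]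
      rw [← LieAlgebra.of_smul, ← LieAlgebra.of_add, Prod.smul_mk, Prod.mk_add_mk, smul_zero,
        add_zero, zero_add, ← map_smul, smul_eq_mul, mul_one, LinearEquiv.symm_apply_apply]
    rw [hy, map_add, map_add, map_smul, map_smul, LevelAlg.mk_c]
    exact add_mem (h1 l) (S.smul_mem (S.algebraMap_mem _) _)
  let f : Affine n →ₗ⁅ℂ⁆ S :=
    { toFun := fun y => ⟨_, h2 y⟩
      map_add' := fun y z => Subtype.ext (by simp only [map_add]; rfl)
      map_smul' := fun c y => Subtype.ext (by simp only [map_smul]; rfl)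
      map_lie' := fun {y z} => Subtype.ext (by
        simp only [LieHom.map_lie, LieRing.of_associative_ring_bracket, map_sub, map_mul]; rfl) }
  have h3 : S.val.comp (UniversalEnvelopingAlgebra.lift ℂ f) = LevelAlg.mk n k := by
    apply UniversalEnvelopingAlgebra.hom_ext
    ext y
    change ((UniversalEnvelopingAlgebra.lift ℂ f (UniversalEnvelopingAlgebra.ι ℂ y) : S) :
      LevelAlg n k) = _
    rw [UniversalEnvelopingAlgebra.lift_ι_apply]
    rfl
  rw [← h3]
  exact (UniversalEnvelopingAlgebra.lift ℂ f u).2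

/-- The algebra `𝒰` is generated by the elements `x(i)`. -/
theorem LevelAlg.induction {n k : ℕ} {p : LevelAlg n k → Prop}
    (scalar : ∀ c : ℂ, p (algebraMap ℂ _ c)) (of : ∀ x i, p (gen k x i))
    (add : ∀ u v, p u → p v → p (u + v)) (mul : ∀ u v, p u → p v → p (u * v))
    (u : LevelAlg n k) : p u := by
  obtain ⟨u, rfl⟩ := LevelAlg.mk_surjective n k u
  let S : Subalgebra ℂ (LevelAlg n k) :=
    { carrier := {u | p u}
      mul_mem' := fun h h' => mul _ _ h h'
      add_mem' := fun h h' => add _ _ h h'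
      algebraMap_mem' := scalar }
  exact LevelAlg.mk_mem (S := S) of u

/-- The left ideal of `𝒰` generated by all `x(i)` with `i ≥ N`. -/
def leftIdeal (n k : ℕ) (N : ℕ) : Submodule (LevelAlg n k) (LevelAlg n k) :=
  Submodule.span (LevelAlg n k) {u | ∃ (x : SpAlg n) (i : ℤ), (N : ℤ) ≤ i ∧ u = gen k x i}

/-! ### The completion of `𝒰` -/

theorem leftIdeal_anti {n k : ℕ} {N M : ℕ} (h : N ≤ M) : leftIdeal n k M ≤ leftIdeal n k N :=
  Submodule.span_mono fun _ ⟨x, i, hi, hu⟩ => ⟨x, i, by omega, hu⟩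

theorem leftIdeal_mul {n k : ℕ} (u : LevelAlg n k) :
    ∀ N : ℕ, ∃ M : ℕ, ∀ v ∈ leftIdeal n k M, v * u ∈ leftIdeal n k N := by
  induction u using LevelAlg.induction with
  | scalar c =>
    intro N
    refine ⟨N, fun v hv => ?_⟩
    rw [← Algebra.commutes]
    exact (leftIdeal n k N).smul_mem _ hv
  | of y j =>
    intro N
    refine ⟨N + j.natAbs + 1, fun v hv => ?_⟩
    induction hv using Submodule.span_induction with
    | mem v hv =>
      obtain ⟨x, i, hi, rfl⟩ := hv
      have h := gen_comm k x y i j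
      rw [if_neg (by omega), zero_mul, map_zero, add_zero, sub_eq_iff_eq_add] at h
      rw [h]
      refine add_mem (Submodule.subset_span ⟨_, _, by omega, rfl⟩) ?_
      exact (leftIdeal n k N).smul_mem _ (Submodule.subset_span ⟨_, _, by omega, rfl⟩)
    | zero => rw [zero_mul]; exact zero_mem _
    | add v w _ _ hv hw => rw [add_mul]; exact add_mem hv hw
    | smul a v _ hv =>
      rw [smul_eq_mul, mul_assoc]
      exact (leftIdeal n k N).smul_mem _ hv
  | add u w hu hw =>
    intro N
    obtain ⟨M, hM⟩ := hu N
    obtain ⟨L, hL⟩ := hw N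
    refine ⟨max M L, fun v hv => ?_⟩
    rw [mul_add]
    exact add_mem (hM v (leftIdeal_anti (le_max_left _ _) hv))
      (hL v (leftIdeal_anti (le_max_right _ _) hv))
  | mul u w hu hw =>
    intro N
    obtain ⟨M, hM⟩ := hw N
    obtain ⟨L, hL⟩ := hu M
    refine ⟨L, fun v hv => ?_⟩
    rw [← mul_assoc]
    exact hM _ (hL v hv)

theorem leftIdeal_basis (n k : ℕ) :
    RingSubgroupsBasis (fun N : ℕ => (leftIdeal n k N).toAddSubgroup) where
  inter i j := ⟨max i j, le_inf (leftIdeal_anti (le_max_left _ _))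
    (leftIdeal_anti (le_max_right _ _))⟩
  mul i := by
    refine ⟨i, ?_⟩
    rintro _ ⟨u, _, v, hv, rfl⟩
    exact (leftIdeal n k i).smul_mem u hv
  leftMul u i := ⟨i, fun v hv => (leftIdeal n k i).smul_mem u hv⟩
  rightMul u i := by
    obtain ⟨M, hM⟩ := leftIdeal_mul u i
    exact ⟨M, fun v hv => hM v hv⟩

/-- The topology on `𝒰` in which the left ideals `leftIdeal n k N`, `N = 0, 1, 2, …`, form a
basis of neighbourhoods of zero. -/
instance (n k : ℕ) : TopologicalSpace (LevelAlg n k) := (leftIdeal_basis n k).topology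

instance (n k : ℕ) : IsTopologicalRing (LevelAlg n k) :=
  (leftIdeal_basis n k).toRingFilterBasis.isTopologicalRing

instance (n k : ℕ) : UniformSpace (LevelAlg n k) :=
  IsTopologicalAddGroup.rightUniformSpace (LevelAlg n k)

instance (n k : ℕ) : IsUniformAddGroup (LevelAlg n k) := isUniformAddGroup_of_addCommGroup

instance (n k : ℕ) : UniformContinuousConstSMul ℂ (LevelAlg n k) :=
  haveI : ContinuousConstSMul ℂ (LevelAlg n k) :=
    ⟨fun c => by simpa only [Algebra.smul_def] using continuous_const_mul _⟩
  uniformContinuousConstSMul_of_continuousConstSMul ℂ (LevelAlg n k)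

/-- The completion of `𝒰`, a complete Hausdorff topological algebra. It contains the infinite
sums of elements of `𝒰` which are, on every vector of every restricted level `k` module,
finite sums. -/
abbrev CompletedAlg (n k : ℕ) : Type := UniformSpace.Completion (LevelAlg n k)

/-- The element `x(i)` of the completion. -/
def cgen {n : ℕ} (k : ℕ) (x : SpAlg n) (i : ℤ) : CompletedAlg n k :=
  ((gen k x i : LevelAlg n k) : CompletedAlg n k)

/-! ### The vertex algebra `N(kΛ₀)` and the relations -/

/-- The generalized Verma module `N(kΛ₀)`, induced from the one-dimensional module on which
`x(i)`, `i ≥ 0`, act as zero and `c` acts as `k`. -/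
abbrev Vac (n k : ℕ) : Type := LevelAlg n k ⧸ leftIdeal n k 0

/-- The vacuum vector `𝟏`. -/
def vac (n k : ℕ) : Vac n k := Submodule.Quotient.mk 1

/-- The graph of the state-field correspondence `v ↦ Y(v, z) = ∑ v_m z^{-m-1}`:
`IsVertexOp v V` says that `V m = v_m` for all `m`. The correspondence is linear, the vacuum
goes to the identity and, for `x ∈ g`, `x(z) = ∑ x(i) z^{-i-1}`,
`(x(p) v)_m = ∑_{i ≥ 0} (-1)^i (p choose i) (x(p-i) v_{m+i} - (-1)^p v_{p+m-i} x(i))`. -/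
inductive IsVertexOp {n k : ℕ} : Vac n k → (ℤ → CompletedAlg n k) → Prop
  | vacuum : IsVertexOp (vac n k) (fun m => if m = -1 then 1 else 0)
  | add (v w : Vac n k) (V W : ℤ → CompletedAlg n k) :
      IsVertexOp v V → IsVertexOp w W → IsVertexOp (v + w) (V + W)
  | smul (c : ℂ) (v : Vac n k) (V : ℤ → CompletedAlg n k) :
      IsVertexOp v V → IsVertexOp (c • v) (c • V)
  | lie (x : SpAlg n) (p : ℤ) (v : Vac n k) (V W : ℤ → CompletedAlg n k) :
      IsVertexOp v V →
      (∀ m : ℤ, HasSum (fun i : ℕ => ((-1) ^ i * Ring.choose p i : ℤ) •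
        (cgen k x (p - i) * V (m + i) -
          (Int.negOnePow p : ℤ) • (V (p + m - i) * cgen k x i))) (W m)) →
      IsVertexOp (gen k x p • v) W

/-- The embedding `x ↦ x(0)` of `g` into `𝒰`. -/
def zeroMode (n k : ℕ) : SpAlg n →ₗ⁅ℂ⁆ LevelAlg n k where
  toFun x := gen k x 0
  map_add' x y := gen_add k x y 0
  map_smul' c x := gen_smul k c x 0
  map_lie' {x y} := by
    have h := gen_comm k x y 0 0
    simp only [Int.cast_zero, zero_mul, ite_self, map_zero, add_zero] at h
    rw [LieRing.of_associative_ring_bracket, h]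

/-- The `g`-module `R = U(g) x_θ(-1)^{k+1} 𝟏 ⊂ N(kΛ₀)`. -/
def relModule {n : ℕ} (k : ℕ) (xθ : SpAlg n) : Set (Vac n k) :=
  {v | ∃ u : UniversalEnvelopingAlgebra ℂ (SpAlg n),
    v = UniversalEnvelopingAlgebra.lift ℂ (zeroMode n k) u • gen k xθ (-1) ^ (k + 1) • vac n k}

/-- The coefficients `r_m`, `r ∈ R`, `m ∈ ℤ`, of the annihilating fields `Y(r, z)`. -/
def relCoeffs {n : ℕ} (k : ℕ) (xθ : SpAlg n) : Set (CompletedAlg n k) :=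
  {ρ | ∃ r ∈ relModule k xθ, ∃ V, IsVertexOp r V ∧ ∃ m : ℤ, ρ = V m}

/-- The space `R̄`, the span of all coefficients `r_m`, `r ∈ R`, `m ∈ ℤ`. -/
def relSpan {n : ℕ} (k : ℕ) (xθ : SpAlg n) : Submodule ℂ (CompletedAlg n k) :=
  Submodule.span ℂ (relCoeffs k xθ)

/-! ### Colored partitions and leading terms -/

/-- The basis `B̄ = {X_{ab}(j)}` of `g ⊗ ℂ[t, t⁻¹]`, ordered by the degree `j` first and then
by the color `ab`. -/
abbrev Part (n : ℕ) : Type := ℤ ×ₗ Place n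

/-- The part `X_{ab}(j)`. -/
def part {n : ℕ} (j : ℤ) (p : Place n) : Part n := toLex (j, p)

/-- Colored partitions: monomials in the elements of `B̄`. -/
abbrev ColPart (n : ℕ) : Type := Multiset (Part n)

/-- The degree `|Π|`. -/
def ColPart.degree {n : ℕ} (Φ : ColPart n) : ℤ := (Φ.map fun q => (ofLex q).1).sum

/-- The shape of `Π`, as the list of degrees of parts read from the right. -/
def ColPart.shape {n : ℕ} (Φ : ColPart n) : List ℤ :=
  (Φ.sort (· ≥ ·)).map fun q => (ofLex q).1

/-- The colors of `Π`, read from the right. -/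
def ColPart.colors {n : ℕ} (Φ : ColPart n) : List (Place n) :=
  (Φ.sort (· ≥ ·)).map fun q => (ofLex q).2

/-- The strict order `≺` on colored partitions. -/
def ColPart.Prec {n : ℕ} (Φ Ψ : ColPart n) : Prop :=
  Ψ.card < Φ.card ∨ (Φ.card = Ψ.card ∧
    (Φ.degree < Ψ.degree ∨ (Φ.degree = Ψ.degree ∧
      (List.Lex (· < ·) Φ.shape Ψ.shape ∨ (Φ.shape = Ψ.shape ∧
        List.Lex (· < ·) Φ.colors Ψ.colors)))))

/-- The monomial `X(Π) = X_1(j_1) ⋯ X_ℓ(j_ℓ)` of `𝒰`, with factors in ascending order. -/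
def monomial {n : ℕ} (k : ℕ) (X : Place n → SpAlg n) (Φ : ColPart n) : LevelAlg n k :=
  ((Φ.sort (· ≤ ·)).map fun q => gen k (X (ofLex q).2) (ofLex q).1).prod

/-- `Φ` is the leading term of `ρ`: there is a (convergent, possibly infinite) expansion
`ρ = c_Φ X(Φ) + ∑_{Ψ ≻ Φ} c_Ψ X(Ψ)` with `c_Φ ≠ 0`. -/
def IsLeadingTerm {n k : ℕ} (X : Place n → SpAlg n) (ρ : CompletedAlg n k) (Φ : ColPart n) :
    Prop :=
  ∃ c : ColPart n → ℂ,
    HasSum (fun Ψ => ((c Ψ • monomial k X Ψ : LevelAlg n k) : CompletedAlg n k)) ρ ∧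
    c Φ ≠ 0 ∧ ∀ Ψ, c Ψ ≠ 0 → Ψ = Φ ∨ ColPart.Prec Φ Ψ

/-! ### Cascades -/

/-- A sequence of places is a cascade if every step goes down in the same column or to the left
in the same row. -/
def IsCascade {n : ℕ} (C : List (Place n)) : Prop :=
  C.IsChain fun p q => (q.row < p.row ∧ q.col = p.col) ∨ (q.row = p.row ∧ p.col < q.col)

/-- The upper triangle `△_r`: the rows `1, …, r`. -/
def upperTriangle {n : ℕ} (r : Idx n) : Set (Place n) := {p | r ≤ p.row}

/-- The lower triangle `ʳ△`: the columns `r, …, 1̲`. -/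
def lowerTriangle {n : ℕ} (r : Idx n) : Set (Place n) := {p | p.col ≤ r}

/-- The colored partition `∏_{α ∈ C} X_α(j)^{m_α}`. -/
def cascadeMonomial {n : ℕ} (j : ℤ) (C : List (Place n)) (m : Place n → ℕ) : ColPart n :=
  (C.map fun p => Multiset.replicate (m p) (part j p)).sum

end AffineC

end

noncomputable section

namespace AffineC

attribute [local instance 100] LieRing.ofAssociativeRing

/-! ### Symmetric products of vectors as elements of the symplectic Lie algebra -/

/-! Identify 𝔤 with the symmetric square of the vector representation, so that `symBasis a b` is the
product e_a e_b. For b ≠ a̲ this is a nonzero multiple of X_{ab}, and e_i e_{i̲} is the sum of the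
simple coroots α_j^∨ with j ≥ i. In every case e_a e_b is therefore a nonzero multiple of X_{ab}
plus strictly larger basis elements (`exists_triangular`).

Since e_1 e_1 is a multiple of x_θ, the field of x_θ(-1)^{k+1} 𝟏 is, up to a scalar, the power (e_1
e_1)(z)^{k+1}. Zero modes act on its coefficients by commutators and polarize it. For every multiset
of 2(k+1) indices, take the sum over all words with that content of the products of elements e_a
e_b; summed over all degrees of given total, this is a coefficient of an annihilating field
(`isRelFamily_symFamily`).

Now take the content of the wanted partition Φ. Expanding in the basis X and sorting gives shorter
monomials, which are larger than Φ, and monomials obtained by raising colors in partitions with the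
content of Φ. It remains to see that Φ is least among partitions with its length, degree and
content. For shapes, this holds because the degrees of Φ differ by at most one
(`ColPart.eq_or_prec`). For colors, regard the place ab as the interval from b to a. Intervals grow
along a cascade, so those of equal degree are nested, and r separates the intervals of degree -j,
which lie below, from those of degree -j-1, which lie above. Among all pairings of a fixed content
into a fixed shape, the nested one is least when compared from the largest part down
(`ColPart.IsNested.not_sort_lex`).

Only words whose places already give Φ contribute to its coefficient, and each contributes the same
nonzero product of diagonal coefficients. Nothing cancels, and the word read off from Φ does occur
(`exists_expansion`). Convergence holds because a product whose largest degree N is nonnegative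
expands into monomials that each contain a part of degree at least N, so the double sum may be
regrouped by monomials (`isLeadingTerm_of_hasSum`). -/

open Matrix in
theorem J_transpose (n : ℕ) : (Matrix.J (Fin n) ℂ)ᵀ = -Matrix.J (Fin n) ℂ :=
  Matrix.J_transpose (Fin n) ℂ

open Matrix in
theorem mem_sp_iff {n : ℕ} (A : Matrix (Fin n ⊕ Fin n) (Fin n ⊕ Fin n) ℂ) :
    A ∈ LieAlgebra.Symplectic.sp (Fin n) ℂ ↔
      Aᵀ * Matrix.J (Fin n) ℂ = Matrix.J (Fin n) ℂ * -A := by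
  change A ∈ skewAdjointMatricesLieSubalgebra _ ↔ _
  rw [mem_skewAdjointMatricesLieSubalgebra, mem_skewAdjointMatricesSubmodule]
  rfl

open Matrix in
/-- The element `(u vᵀ + v uᵀ) J` of the symplectic Lie algebra, which identifies the symmetric
square of the vector representation with the adjoint representation. -/
def symProd {n : ℕ} (u v : Fin n ⊕ Fin n → ℂ) : SpAlg n :=
  ⟨(vecMulVec u v + vecMulVec v u) * Matrix.J (Fin n) ℂ, by
    rw [mem_sp_iff, transpose_mul, J_transpose, transpose_add, transpose_vecMulVec,
      transpose_vecMulVec, add_comm (vecMulVec v u)]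
    simp only [neg_mul, mul_neg, Matrix.mul_assoc]⟩

open Matrix in
theorem symProd_val {n : ℕ} (u v : Fin n ⊕ Fin n → ℂ) :
    (symProd u v).val = (vecMulVec u v + vecMulVec v u) * Matrix.J (Fin n) ℂ := rfl

theorem symProd_comm {n : ℕ} (u v : Fin n ⊕ Fin n → ℂ) : symProd u v = symProd v u :=
  Subtype.ext (by rw [symProd_val, symProd_val, add_comm])

theorem symProd_add_left {n : ℕ} (u u' v : Fin n ⊕ Fin n → ℂ) :
    symProd (u + u') v = symProd u v + symProd u' v :=
  Subtype.ext (by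
    change _ = (symProd u v).val + (symProd u' v).val
    simp only [symProd_val, Matrix.add_vecMulVec, Matrix.vecMulVec_add, Matrix.add_mul]
    abel)

theorem symProd_smul_left {n : ℕ} (c : ℂ) (u v : Fin n ⊕ Fin n → ℂ) :
    symProd (c • u) v = c • symProd u v :=
  Subtype.ext (by
    change _ = c • (symProd u v).val
    simp only [symProd_val, Matrix.smul_vecMulVec, Matrix.vecMulVec_smul, ← smul_add,
      Matrix.smul_mul])

-- The defining relation Aᵀ J = -J A moves the right factor A across J. The commutator then becomes
-- the derivation action of A on the two vectors.
open Matrix in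
theorem lie_symProd {n : ℕ} (A : SpAlg n) (u v : Fin n ⊕ Fin n → ℂ) :
    ⁅A, symProd u v⁆ = symProd (A.val *ᵥ u) v + symProd u (A.val *ᵥ v) := by
  have hA : Matrix.J (Fin n) ℂ * A.val = -(A.valᵀ * Matrix.J (Fin n) ℂ) := by
    rw [(mem_sp_iff A.val).1 A.2, mul_neg, neg_neg]
  apply Subtype.ext
  change A.val * (symProd u v).val - (symProd u v).val * A.val =
    (symProd (A.val *ᵥ u) v).val + (symProd u (A.val *ᵥ v)).val
  simp only [symProd_val]
  rw [Matrix.mul_assoc _ _ A.val, hA, mul_neg, sub_neg_eq_add, ← Matrix.mul_assoc A.val,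
    ← Matrix.mul_assoc _ A.valᵀ, ← add_mul, ← add_mul]
  congr 1
  simp only [mul_add, add_mul, mul_vecMulVec, vecMulVec_mul, vecMul_transpose]
  abel

/-- The coordinate of the vector representation labelled by an index. -/
def Idx.toSum {n : ℕ} : Idx n → Fin n ⊕ Fin n
  | .plain i => .inl i
  | .under i => .inr i

theorem Idx.toSum_injective {n : ℕ} : Function.Injective (Idx.toSum (n := n)) := by
  rintro (i | i) (j | j) h <;> simp_all [Idx.toSum]

theorem Idx.exists_toSum {n : ℕ} (s : Fin n ⊕ Fin n) : ∃ a : Idx n, a.toSum = s := by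
  rcases s with i | i
  · exact ⟨.plain i, rfl⟩
  · exact ⟨.under i, rfl⟩

instance (n : ℕ) : Fintype (Idx n) :=
  Fintype.ofInjective _ Idx.toSum_injective

instance (n : ℕ) : Fintype (Place n) :=
  Fintype.ofInjective (fun p : Place n => (p.col, p.row)) fun p q h => by
    rw [Prod.mk.injEq] at h
    exact Place.ext h.1 h.2

theorem Idx.bar_bar {n : ℕ} (a : Idx n) : a.bar.bar = a := by
  rcases a with i | i <;> rfl

theorem Idx.bar_ne {n : ℕ} (a : Idx n) : a.bar ≠ a := by
  rcases a with i | i <;> simp [Idx.bar]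

theorem Idx.bar_injective {n : ℕ} : Function.Injective (Idx.bar (n := n)) :=
  fun a b h => by rw [← a.bar_bar, h, b.bar_bar]

/-- The standard basis vector labelled by an index. -/
def Idx.vec {n : ℕ} (a : Idx n) : Fin n ⊕ Fin n → ℂ := Pi.single a.toSum 1

/-- The element of the symplectic Lie algebra labelled by a pair of indices. -/
def symBasis {n : ℕ} (a b : Idx n) : SpAlg n := symProd a.vec b.vec

theorem symBasis_comm {n : ℕ} (a b : Idx n) : symBasis a b = symBasis b a := symProd_comm _ _

/-- The sign of an index. -/
def Idx.sign {n : ℕ} : Idx n → ℂ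
  | .plain _ => 1
  | .under _ => -1

theorem Idx.sign_ne_zero {n : ℕ} (a : Idx n) : a.sign ≠ 0 := by
  rcases a with i | i <;> simp [Idx.sign]

open Matrix in
theorem J_mulVec_vec {n : ℕ} (a : Idx n) :
    Matrix.J (Fin n) ℂ *ᵥ a.vec = a.sign • a.bar.vec := by
  rw [Idx.vec, mulVec_single_one]
  ext s
  rcases a with i | i <;> rcases s with j | j <;>
    simp [Idx.toSum, Idx.bar, Idx.sign, Idx.vec, Matrix.J, Pi.single_apply, Matrix.one_apply]
  split_ifs <;> simp

open Matrix in
theorem vec_vecMul_J {n : ℕ} (a : Idx n) :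
    a.vec ᵥ* Matrix.J (Fin n) ℂ = -(a.sign • a.bar.vec) := by
  rw [← J_mulVec_vec, ← mulVec_transpose, J_transpose, neg_mulVec]

theorem vec_dotProduct_vec {n : ℕ} (a b : Idx n) :
    a.vec ⬝ᵥ b.vec = if a = b then (1 : ℂ) else 0 := by
  simp only [Idx.vec, single_dotProduct, one_mul, Pi.single_apply, Idx.toSum_injective.eq_iff]

open Matrix in
theorem symBasis_mulVec_vec {n : ℕ} (a b c : Idx n) :
    (symBasis a b).val *ᵥ c.vec =
      c.sign • ((if b = c.bar then (1 : ℂ) else 0) • a.vec +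
        (if a = c.bar then (1 : ℂ) else 0) • b.vec) := by
  rw [symBasis, symProd_val, ← mulVec_mulVec, J_mulVec_vec, mulVec_smul, add_mulVec,
    vecMulVec_mulVec, vecMulVec_mulVec, vec_dotProduct_vec, vec_dotProduct_vec]
  simp only [op_smul_eq_smul]

theorem cartan_val {n : ℕ} (h : Fin n → ℂ) :
    (cartan h).val = Matrix.diagonal (Sum.elim h (-h)) := rfl

theorem symBasis_bar {n : ℕ} (i : Fin n) :
    symBasis (.plain i) (.under i) = cartan (Pi.single i 1) := by
  apply Subtype.ext
  rw [symBasis, symProd_val, add_mul, Matrix.vecMulVec_mul, Matrix.vecMulVec_mul, vec_vecMul_J,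
    vec_vecMul_J, cartan_val]
  ext (s | s) (t | t) <;>
    simp [Idx.toSum, Idx.bar, Idx.sign, Idx.vec, Matrix.vecMulVec_apply, Pi.single_apply,
      Matrix.diagonal_apply] <;> aesop

theorem cartan_add {n : ℕ} (h h' : Fin n → ℂ) : cartan (h + h') = cartan h + cartan h' := by
  apply Subtype.ext
  change _ = (cartan h).val + (cartan h').val
  rw [cartan_val, cartan_val, cartan_val, Matrix.diagonal_add]
  congr 1
  ext (i | i) <;> simp [add_comm]

theorem cartan_injective {n : ℕ} : Function.Injective (cartan (n := n)) := by
  intro h h' e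
  have := congrArg Subtype.val e
  rw [cartan_val, cartan_val] at this
  funext i
  simpa using congrFun (Matrix.diagonal_injective this) (Sum.inl i)

theorem cartan_zero {n : ℕ} : cartan (0 : Fin n → ℂ) = 0 := by
  have := cartan_add (0 : Fin n → ℂ) 0
  rwa [add_zero, left_eq_add] at this

open Matrix in
/-- Every element of the symplectic Lie algebra is a combination of the elements `symBasis s t`,
with coefficients given by the matrix entries. -/
theorem eq_sum_symBasis {n : ℕ} (A : SpAlg n) :
    A = ∑ s : Idx n, ∑ t : Idx n,
      (-(1 / 2 : ℂ) * (t.sign * A.val s.toSum t.bar.toSum)) • symBasis s t := by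
  have key : ∀ S : Matrix (Fin n ⊕ Fin n) (Fin n ⊕ Fin n) ℂ, Sᵀ = S →
      S = ∑ s : Idx n, ∑ t : Idx n, ((1 / 2 : ℂ) * S s.toSum t.toSum) •
        (vecMulVec s.vec t.vec + vecMulVec t.vec s.vec) := by
    intro S hS
    ext i j
    obtain ⟨a, rfl⟩ := Idx.exists_toSum i
    obtain ⟨b, rfl⟩ := Idx.exists_toSum j
    simp only [Matrix.sum_apply, Matrix.smul_apply, Matrix.add_apply, vecMulVec_apply, Idx.vec,
      Pi.single_apply, Idx.toSum_injective.eq_iff, smul_eq_mul, mul_add, mul_ite, mul_one,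
      mul_zero, Finset.sum_add_distrib, Finset.sum_ite_eq, Finset.mem_univ, if_true,
      Finset.sum_ite_irrel, Finset.sum_const_zero]
    have : S b.toSum a.toSum = S a.toSum b.toSum := congrFun (congrFun hS _) _
    rw [this]
    ring
  have hJ : Matrix.J (Fin n) ℂ * Matrix.J (Fin n) ℂ = -1 := Matrix.J_squared (Fin n) ℂ
  -- Membership of A in the symplectic algebra is exactly the symmetry of A J, and J² = -1 recovers
  -- A from it.
  have hS : (-(A.val * Matrix.J (Fin n) ℂ))ᵀ = -(A.val * Matrix.J (Fin n) ℂ) := by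
    have h := (mem_sp_iff A.val).1 A.2
    have h2 := congrArg (fun M => Matrix.J (Fin n) ℂ * M * Matrix.J (Fin n) ℂ) h
    simp only [← Matrix.mul_assoc, hJ] at h2
    rw [Matrix.mul_assoc, hJ] at h2
    rw [transpose_neg, transpose_mul, J_transpose, neg_mul, neg_neg]
    simp only [mul_neg, mul_one, neg_mul, one_mul, neg_neg] at h2
    rw [← h2, neg_neg]
  have hval : ∀ s t : Idx n, (-(A.val * Matrix.J (Fin n) ℂ)) s.toSum t.toSum =
      -(t.sign * A.val s.toSum t.bar.toSum) := by
    intro s t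
    have := congrFun (congrArg (fun v => A.val *ᵥ v) (J_mulVec_vec t)) s.toSum
    rw [mulVec_mulVec, mulVec_smul] at this
    simp only [Idx.vec, mulVec_single_one, Pi.smul_apply, smul_eq_mul, col_apply] at this
    rw [Matrix.neg_apply, this]
  apply Subtype.ext
  have hA : A.val = -(A.val * Matrix.J (Fin n) ℂ) * Matrix.J (Fin n) ℂ := by
    rw [neg_mul, Matrix.mul_assoc, hJ]; simp
  have hc : ∀ (f : Idx n → Idx n → SpAlg n), (∑ s, ∑ t, f s t).val = ∑ s, ∑ t, (f s t).val := by
    intro f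
    rw [← LieSubalgebra.coe_incl, map_sum]
    simp only [map_sum]
  rw [hc]
  conv_lhs => rw [hA, key _ hS]
  simp only [hval, Finset.sum_mul]
  refine Finset.sum_congr rfl fun s _ => Finset.sum_congr rfl fun t _ => ?_
  rw [smul_mul_assoc, ← neg_mul_comm]
  rfl

theorem Idx.weight_bar {n : ℕ} (h : Fin n → ℂ) (a : Idx n) : a.bar.weight h = -a.weight h := by
  rcases a with i | i <;> simp [Idx.bar, Idx.weight]

/-- A nonzero weight of the adjoint representation determines the pair of indices. -/
theorem Idx.pair_eq_of_weight_eq {n : ℕ} {a b s t : Idx n} (hab : b ≠ a.bar)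
    (h : ∀ x : Fin n → ℂ, s.weight x + t.weight x = a.weight x + b.weight x) :
    (s = a ∧ t = b) ∨ (s = b ∧ t = a) := by
  have h1 : ∀ i : Fin n, _ := fun i => h (Pi.single i 1)
  rcases a with a | a <;> rcases b with b | b <;> rcases s with s | s <;> rcases t with t | t <;>
    simp only [Idx.weight, Idx.bar, Pi.single_apply, ne_eq, Idx.under.injEq, Idx.plain.injEq,
      reduceCtorEq, not_false_eq_true, false_and, and_false, or_false, false_or] at * <;>
    have ha := h1 a <;> have hb := h1 b <;> have hs := h1 s <;> have ht := h1 t <;>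
    clear h h1 <;> grind

/-- A root vector is a multiple of the corresponding symmetric product. -/
theorem exists_eq_smul_symBasis {n : ℕ} {a b : Idx n} (hab : b ≠ a.bar) (A : SpAlg n)
    (hA : ∀ h, ⁅cartan h, A⁆ = (a.weight h + b.weight h) • A) :
    ∃ c : ℂ, A = c • symBasis a b := by
  have hz : ∀ s t : Idx n, A.val s.toSum t.bar.toSum ≠ 0 →
      (s = a ∧ t = b) ∨ (s = b ∧ t = a) := by
    intro s t hst
    refine Idx.pair_eq_of_weight_eq hab fun h => ?_
    have h1 := congrArg (fun B : SpAlg n => B.val s.toSum t.bar.toSum) (hA h)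
    have h2 : (⁅cartan h, A⁆ : SpAlg n).val s.toSum t.bar.toSum =
        ((cartan h).val * A.val - A.val * (cartan h).val) s.toSum t.bar.toSum := rfl
    have h3 : ((a.weight h + b.weight h) • A : SpAlg n).val s.toSum t.bar.toSum =
        (a.weight h + b.weight h) * A.val s.toSum t.bar.toSum := rfl
    have hw : ∀ u : Idx n, Sum.elim h (-h) u.toSum = u.weight h := by
      rintro (i | i) <;> simp [Idx.toSum, Idx.weight]
    simp only [h2, h3, Matrix.sub_apply, cartan_val, Matrix.diagonal_mul, Matrix.mul_diagonal, hw,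
      Idx.weight_bar] at h1
    apply mul_right_cancel₀ hst
    rw [← h1]
    ring
  -- The scalar is the sum of all coefficients of A: those not attached to the pair {a, b} vanish,
  -- and the remaining ones multiply the same element.
  refine ⟨∑ s : Idx n, ∑ t : Idx n, (-(1 / 2 : ℂ) * (t.sign * A.val s.toSum t.bar.toSum)),
    (eq_sum_symBasis A).trans ?_⟩
  rw [Finset.sum_smul]
  refine Finset.sum_congr rfl fun s _ => ?_
  rw [Finset.sum_smul]
  refine Finset.sum_congr rfl fun t _ => ?_
  by_cases hst : A.val s.toSum t.bar.toSum = 0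
  · simp [hst]
  · rcases hz s t hst with ⟨rfl, rfl⟩ | ⟨rfl, rfl⟩
    · rfl
    · rw [symBasis_comm]

theorem coroot_ne_zero {n : ℕ} (p : Place n) (hp : p.row ≠ p.col.bar) : coroot p ≠ 0 := by
  intro h
  unfold coroot at h
  have key : ∀ a b : Idx n, b ≠ a.bar → a.eps + b.eps ≠ 0 := by
    intro a b hab h0
    rcases a with a | a <;> rcases b with b | b <;>
      have ha := congrFun h0 a <;>
      simp [Idx.eps, Idx.bar, Pi.single_apply] at hab ha <;> grind
  split_ifs at h with hc
  · rw [← cartan_zero] at h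
    have := cartan_injective h
    exact key p.col p.col p.col.bar_ne.symm (by rw [this, add_zero])
  · rw [← cartan_zero] at h
    exact key p.col p.row hp (cartan_injective h)

theorem Idx.lt_iff {n : ℕ} {a b : Idx n} : a < b ↔ b.pos < a.pos := Iff.rfl

theorem Place.le_iff {n : ℕ} {p q : Place n} :
    p ≤ q ↔ p.row < q.row ∨ (p.row = q.row ∧ p.col ≤ q.col) := Prod.Lex.le_iff

theorem Place.lt_iff {n : ℕ} {p q : Place n} :
    p < q ↔ p.row < q.row ∨ (p.row = q.row ∧ p.col < q.col) := Prod.Lex.lt_iff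

theorem Place.zero_lt_zero {n : ℕ} {i j : Fin n} (h : i < j) : Place.zero i < Place.zero j := by
  rw [Place.lt_iff]
  left
  simp only [Place.zero, Idx.lt_iff, Idx.pos]
  have := i.2
  have := j.2
  have : i.val < j.val := h
  omega

theorem Place.eq_zero_of_row_eq {n : ℕ} {p : Place n} (h : p.row = p.col.bar) :
    ∃ i, p = Place.zero i := by
  obtain ⟨a, b, hab⟩ := p
  obtain rfl : b = a.bar := h
  rcases a with i | i
  · exact ⟨i, rfl⟩
  · exfalso
    rw [Idx.le_iff] at hab
    simp only [Idx.bar, Idx.pos] at hab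
    omega

/-! ### Triangularity of the symmetric products with respect to the basis X. -/

namespace IsTriangularBasis

variable {n : ℕ} {X : Place n → SpAlg n}

theorem exists_symBasis_eq_smul (hX : IsTriangularBasis X) {p : Place n}
    (hp : p.row ≠ p.col.bar) :
    ∃ c : ℂ, c ≠ 0 ∧ symBasis p.col p.row = c • X p := by
  obtain ⟨c, hc⟩ := exists_eq_smul_symBasis hp (X p) (hX.root_vector p hp)
  have hc0 : c ≠ 0 := by
    rintro rfl
    rw [zero_smul] at hc
    apply coroot_ne_zero p hp
    rw [← hX.lie_neg p hp, hc, zero_lie]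
  exact ⟨c⁻¹, inv_ne_zero hc0, by rw [hc, smul_smul, inv_mul_cancel₀ hc0, one_smul]⟩

/-- Telescoping: ε_i = (ε_i - ε_{i+1}) + ε_{i+1}, by descending induction from the long root. The
places of weight zero increase with i, so the new term is the least one. -/
theorem exists_cartan_eq_sum (hX : IsTriangularBasis X) (m : ℕ) (i : Fin n)
    (hm : n = i.val + 1 + m) :
    ∃ g : Place n → ℂ, g (Place.zero i) ≠ 0 ∧ (∀ q, g q ≠ 0 → Place.zero i ≤ q) ∧
      cartan (Pi.single i 1) = ∑ q, g q • X q := by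
  classical
  induction m generalizing i with
  | zero =>
    refine ⟨Pi.single (Place.zero i) 1, by simp, fun q hq => ?_, ?_⟩
    · by_contra h
      exact hq (Pi.single_eq_of_ne (fun e => h e.ge) _)
    · simp only [Pi.single_apply, ite_smul, one_smul, zero_smul, Finset.sum_ite_eq',
        Finset.mem_univ, if_true]
      rw [hX.zero_weight, simpleCoroot, dif_neg (by omega)]
  | succ m ih =>
    have hi : i.val + 1 < n := by omega
    obtain ⟨g, hg0, hg1, hg2⟩ := ih ⟨i.val + 1, hi⟩ (by simp only; omega)
    have hlt : Place.zero i < Place.zero ⟨i.val + 1, hi⟩ :=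
      Place.zero_lt_zero (Fin.lt_def.2 (Nat.lt_succ_self _))
    have hgi : g (Place.zero i) = 0 := by
      by_contra h
      exact absurd (hg1 _ h) (not_le.2 hlt)
    refine ⟨Pi.single (Place.zero i) 1 + g, by simp [hgi], fun q hq => ?_, ?_⟩
    · by_cases hq0 : q = Place.zero i
      · exact hq0.ge
      · rw [Pi.add_apply, Pi.single_eq_of_ne hq0, zero_add] at hq
        exact hlt.le.trans (hg1 q hq)
    · simp only [Pi.add_apply, add_smul, Finset.sum_add_distrib, ← hg2, Pi.single_apply, ite_smul,
        one_smul, zero_smul, Finset.sum_ite_eq', Finset.mem_univ, if_true]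
      rw [hX.zero_weight, simpleCoroot, dif_pos hi, ← cartan_add]
      congr 1
      abel

/-- The symmetric products are triangular with respect to the triangular basis. -/
theorem exists_triangular (hX : IsTriangularBasis X) :
    ∃ γ : Place n → Place n → ℂ, (∀ p, γ p p ≠ 0) ∧ (∀ p q, γ p q ≠ 0 → p ≤ q) ∧
      ∀ p, symBasis p.col p.row = ∑ q, γ p q • X q := by
  classical
  have h : ∀ p : Place n, ∃ g : Place n → ℂ, g p ≠ 0 ∧ (∀ q, g q ≠ 0 → p ≤ q) ∧
      symBasis p.col p.row = ∑ q, g q • X q := by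
    intro p
    by_cases hp : p.row = p.col.bar
    · obtain ⟨i, rfl⟩ := Place.eq_zero_of_row_eq hp
      have := hX.exists_cartan_eq_sum (n - (i.val + 1)) i (by omega)
      rwa [← symBasis_bar] at this
    · obtain ⟨c, hc0, hc⟩ := hX.exists_symBasis_eq_smul hp
      refine ⟨Pi.single p c, by simpa, fun q hq => ?_, ?_⟩
      · by_contra h
        exact hq (Pi.single_eq_of_ne (fun e => h e.ge) _)
      · simp only [Pi.single_apply, ite_smul, zero_smul, Finset.sum_ite_eq',
          Finset.mem_univ, if_true, hc]
  choose γ h1 h2 h3 using h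
  exact ⟨γ, h1, h2, h3⟩

theorem exists_eq_sum (hX : IsTriangularBasis X) (A : SpAlg n) :
    ∃ g : Place n → ℂ, A = ∑ q, g q • X q := by
  have hE : ∀ s t : Idx n, symBasis s t ∈ Submodule.span ℂ (Set.range X) := by
    obtain ⟨γ, -, -, hγ⟩ := hX.exists_triangular
    have : ∀ s t : Idx n, s ≤ t → symBasis s t ∈ Submodule.span ℂ (Set.range X) := by
      intro s t hst
      rw [symBasis_comm, hγ ⟨t, s, hst⟩]
      exact Submodule.sum_mem _ fun q _ =>
        Submodule.smul_mem _ _ (Submodule.subset_span ⟨q, rfl⟩)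
    intro s t
    rcases le_total s t with h | h
    · exact this s t h
    · rw [symBasis_comm]; exact this t s h
  have hA : A ∈ Submodule.span ℂ (Set.range X) := by
    rw [eq_sum_symBasis A]
    exact Submodule.sum_mem _ fun s _ => Submodule.sum_mem _ fun t _ =>
      Submodule.smul_mem _ _ (hE s t)
  obtain ⟨g, hg⟩ := (Submodule.mem_span_range_iff_exists_fun ℂ).1 hA
  exact ⟨g, hg.symm⟩

end IsTriangularBasis

/-! ### Comparison of multisets through their descending lists -/

theorem card_filter_map_eq {ι α : Type*} [Fintype ι] (f : ι → α) (p : α → Prop)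
    [DecidablePred p] :
    ((Finset.univ.val.map f).filter p).card = (Finset.univ.filter fun i => p (f i)).card := by
  rw [Multiset.filter_map, Multiset.card_map]
  rfl

section Multiset

variable {α : Type*} [LinearOrder α]

/-- For descending lists of equal length, the first entry of `L₂` at the point of difference is the
largest value whose multiplicities differ. This turns lexicographic comparison into counting. -/
theorem exists_count_lt_of_lex {L₁ L₂ : List α} (h₁ : L₁.Pairwise (· ≥ ·))
    (h₂ : L₂.Pairwise (· ≥ ·)) (hl : L₁.length = L₂.length) (h : List.Lex (· < ·) L₁ L₂) :
    ∃ z, L₁.count z < L₂.count z ∧ ∀ w, z < w → L₁.count w = L₂.count w := by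
  induction h with
  | nil => simp at hl
  | @cons x s t _ ih =>
    obtain ⟨z, hz, hw⟩ := ih (List.pairwise_cons.1 h₁).2 (List.pairwise_cons.1 h₂).2
      (by simpa using hl)
    refine ⟨z, ?_, fun w h => ?_⟩
    · simp only [List.count_cons]; omega
    · simp only [List.count_cons, hw w h]
  | @rel x s y t hxy =>
    have hs : ∀ w, x < w → (x :: s).count w = 0 := by
      intro w hw
      refine List.count_eq_zero_of_not_mem fun hm => ?_
      rcases List.mem_cons.1 hm with rfl | hm
      · exact lt_irrefl _ hw
      · exact absurd ((List.pairwise_cons.1 h₁).1 w hm) (not_le.2 hw)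
    refine ⟨y, ?_, fun w hw => ?_⟩
    · rw [hs y hxy]
      exact List.count_pos_iff.2 List.mem_cons_self
    · rw [hs w (hxy.trans hw)]
      refine (List.count_eq_zero_of_not_mem fun hm => ?_).symm
      rcases List.mem_cons.1 hm with rfl | hm
      · exact lt_irrefl _ hw
      · exact absurd ((List.pairwise_cons.1 h₂).1 w hm) (not_le.2 hw)

theorem exists_count_lt_of_sort_lex {S T : Multiset α} (hc : S.card = T.card)
    (h : List.Lex (· < ·) (S.sort (· ≥ ·)) (T.sort (· ≥ ·))) :
    ∃ z, S.count z < T.count z ∧ S.filter (z < ·) = T.filter (z < ·) := by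
  obtain ⟨z, hz, hw⟩ := exists_count_lt_of_lex (Multiset.pairwise_sort _ _)
    (Multiset.pairwise_sort _ _) (by simpa using hc) h
  simp only [← Multiset.coe_count, Multiset.sort_eq] at hz hw
  refine ⟨z, hz, Multiset.ext.2 fun w => ?_⟩
  simp only [Multiset.count_filter]
  split_ifs with h
  · exact hw w h
  · rfl

/-- Cancelling the common parts above `z` localizes additive invariants, such as content and shape,
to the parts not above `z`. -/
theorem sum_map_filter_le_eq {S T : Multiset α} {z : α}
    (hST : S.filter (z < ·) = T.filter (z < ·)) {f : α → ℤ}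
    (h : (S.map f).sum = (T.map f).sum) :
    ((S.filter (¬ z < ·)).map f).sum = ((T.filter (¬ z < ·)).map f).sum := by
  rw [← Multiset.filter_add_not (z < ·) S, ← Multiset.filter_add_not (z < ·) T] at h
  simp only [Multiset.map_add, Multiset.sum_add, hST] at h
  exact add_left_cancel h

/-- Pointwise raising can only increase the number of values at or above any threshold, whereas a
lexicographic decrease would lower that number at the first difference. -/
theorem not_sort_lex_of_le {ι : Type*} [Fintype ι] {f g : ι → α} (hfg : ∀ i, f i ≤ g i) :
    ¬ List.Lex (· < ·) ((Finset.univ.val.map g).sort (· ≥ ·))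
      ((Finset.univ.val.map f).sort (· ≥ ·)) := by
  intro h
  obtain ⟨z, hz, hw⟩ := exists_count_lt_of_sort_lex (by simp) h
  have key : ∀ S : Multiset α,
      (S.filter (z ≤ ·)).card = S.count z + (S.filter (z < ·)).card := by
    intro S
    induction S using Multiset.induction_on with
    | empty => simp
    | cons a S ih =>
      simp only [Multiset.filter_cons, Multiset.card_add, ih, Multiset.count_cons]
      rcases lt_trichotomy a z with h | rfl | h
      · simp [not_le.2 h, not_lt.2 h.le, h.ne']
      · simp; omega
      · simp [h, h.le, h.ne]; omega
  have h1 := key (Finset.univ.val.map f)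
  have h2 := key (Finset.univ.val.map g)
  rw [card_filter_map_eq] at h1 h2
  have h3 : (Finset.univ.filter fun i => z ≤ f i).card ≤
      (Finset.univ.filter fun i => z ≤ g i).card := by
    refine Finset.card_le_card fun i hi => ?_
    simp only [Finset.mem_filter, Finset.mem_univ, true_and] at hi ⊢
    exact hi.trans (hfg i)
  rw [hw] at h2
  omega

theorem eq_of_le_of_map_eq {ι : Type*} [Fintype ι] {f g : ι → α} (hfg : ∀ i, f i ≤ g i)
    (h : Finset.univ.val.map f = Finset.univ.val.map g) : f = g := by
  funext i
  refine le_antisymm (hfg i) ?_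
  have h1 := congrArg (fun S => (Multiset.filter (g i ≤ ·) S).card) h
  simp only [card_filter_map_eq] at h1
  have h2 : (Finset.univ.filter fun j => g i ≤ f j) = Finset.univ.filter fun j => g i ≤ g j := by
    refine Finset.eq_of_subset_of_card_le (fun j hj => ?_) h1.ge
    simp only [Finset.mem_filter, Finset.mem_univ, true_and] at hj ⊢
    exact hj.trans (hfg j)
  have h3 : i ∈ Finset.univ.filter fun j => g i ≤ g j := by simp
  rw [← h2] at h3
  simpa using h3

/-- With equal shapes, the first two differing parts have the same degree and so differ by color
alone. -/
theorem lex_map_snd {ι β : Type*} [LinearOrder ι] [LinearOrder β] {L₁ L₂ : List (ι ×ₗ β)}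
    (h : List.Lex (· < ·) L₁ L₂)
    (he : L₁.map (fun q => (ofLex q).1) = L₂.map (fun q => (ofLex q).1)) :
    List.Lex (· < ·) (L₁.map fun q => (ofLex q).2) (L₂.map fun q => (ofLex q).2) := by
  induction h with
  | nil => simp at he
  | cons _ ih =>
    simp only [List.map_cons, List.cons.injEq, true_and] at he ⊢
    exact List.Lex.cons (ih he)
  | rel hxy =>
    simp only [List.map_cons, List.cons.injEq] at he ⊢
    rcases Prod.Lex.lt_iff.1 hxy with h | h
    · exact absurd he.1 h.ne
    · exact List.Lex.rel h.2

/-- Balanced shapes are minimal: at the first difference x < y, every later entry of `L₁` is at most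
x, while every later entry of `L₂` is at least y - 1 ≥ x. -/
theorem sum_lt_sum_of_lex {L₁ L₂ : List ℤ} (h : List.Lex (· < ·) L₁ L₂)
    (h₁ : L₁.Pairwise (· ≥ ·)) (hl : L₁.length = L₂.length)
    (h₂ : ∀ x ∈ L₂, ∀ y ∈ L₂, x ≤ y + 1) : L₁.sum < L₂.sum := by
  induction h with
  | nil => simp at hl
  | cons _ ih =>
    rw [List.sum_cons, List.sum_cons]
    have := ih (List.pairwise_cons.1 h₁).2 (by simpa using hl)
      fun x hx y hy => h₂ x (List.mem_cons_of_mem _ hx) y (List.mem_cons_of_mem _ hy)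
    omega
  | @rel x s y t hxy =>
    rw [List.sum_cons, List.sum_cons]
    have h3 := List.sum_le_card_nsmul s x (List.pairwise_cons.1 h₁).1
    have h4 := List.card_nsmul_le_sum t x fun z hz => by
      have := h₂ y List.mem_cons_self z (List.mem_cons_of_mem _ hz)
      omega
    have h5 : s.length = t.length := by simpa using hl
    rw [h5] at h3
    omega

end Multiset

/-! ### Minimality of nested colored partitions -/

/-- The multiset of all the column and row indices of a colored partition. -/
def ColPart.content {n : ℕ} (Φ : ColPart n) : Multiset (Idx n) :=
  Φ.map (fun q => (ofLex q).2.col) + Φ.map (fun q => (ofLex q).2.row)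

/-- The places of equal degree are nested, and the indices of parts of larger degree are smaller
than those of parts of smaller degree. -/
structure ColPart.IsNested {n : ℕ} (Φ : ColPart n) : Prop where
  nested : ∀ x ∈ Φ, ∀ y ∈ Φ, (ofLex x).1 = (ofLex y).1 →
    ((ofLex x).2.row ≤ (ofLex y).2.row ∧ (ofLex y).2.col ≤ (ofLex x).2.col) ∨
    ((ofLex y).2.row ≤ (ofLex x).2.row ∧ (ofLex x).2.col ≤ (ofLex y).2.col)
  separated : ∀ x ∈ Φ, ∀ y ∈ Φ, (ofLex y).1 < (ofLex x).1 →
    (ofLex x).2.col ≤ (ofLex y).2.row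

theorem Part.not_lt_iff {n : ℕ} {x z : Part n} : ¬ z < x ↔ (ofLex x).1 < (ofLex z).1 ∨
    ((ofLex x).1 = (ofLex z).1 ∧ ((ofLex x).2.row < (ofLex z).2.row ∨
      ((ofLex x).2.row = (ofLex z).2.row ∧ (ofLex x).2.col ≤ (ofLex z).2.col))) := by
  rw [not_lt, Prod.Lex.le_iff, Place.le_iff]

theorem Part.ext_iff {n : ℕ} {x z : Part n} : x = z ↔ (ofLex x).1 = (ofLex z).1 ∧
    (ofLex x).2.row = (ofLex z).2.row ∧ (ofLex x).2.col = (ofLex z).2.col := by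
  constructor
  · rintro rfl; exact ⟨rfl, rfl, rfl⟩
  · rintro ⟨h1, h2, h3⟩
    exact ofLex_inj.1 (Prod.ext h1 (Place.ext h3 h2))

/-- Let z be the largest part whose multiplicities differ, with more copies in Φ. Among the parts
not above z, count the indices below the row of z and then those below its column. Both totals agree
for Φ and Ψ. Each part of the degree of z has a minimal possible contribution to them; nesting and
separation force Φ to attain this minimum, and Ψ can only exceed it. Comparing the totals gives Ψ at
least as many copies of z as Φ. -/
theorem ColPart.IsNested.not_sort_lex {n : ℕ} {Φ Ψ : ColPart n} (hΦ : Φ.IsNested)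
    (hshape : Φ.map (fun q => (ofLex q).1) = Ψ.map (fun q => (ofLex q).1))
    (hcont : Φ.content = Ψ.content) :
    ¬ List.Lex (· < ·) (Ψ.sort (· ≥ ·)) (Φ.sort (· ≥ ·)) := by
  intro h
  have hcard : Ψ.card = Φ.card := by simpa using (congrArg Multiset.card hshape).symm
  obtain ⟨z, hz, hw⟩ := exists_count_lt_of_sort_lex hcard h
  have hzΦ : z ∈ Φ := Multiset.count_pos.1 (by omega)
  have hcount : ∀ S : ColPart n, ((S.filter (¬ z < ·)).map fun x => if x = z then (1 : ℤ) else 0).sum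
      = S.count z := by
    intro S
    induction S using Multiset.induction_on with
    | empty => simp
    | cons x S ih =>
      rw [Multiset.filter_cons, Multiset.map_add, Multiset.sum_add, ih, Multiset.count_cons]
      by_cases hx : x = z
      · subst hx; simp; ring
      · rw [if_neg (Ne.symm hx)]
        split_ifs <;> simp [hx]
  have hidx : ∀ c : Idx n, ((Ψ.filter (¬ z < ·)).map fun x =>
        (if (ofLex x).2.row < c then (1 : ℤ) else 0) + (if (ofLex x).2.col < c then 1 else 0)).sum =
      ((Φ.filter (¬ z < ·)).map fun x =>
        (if (ofLex x).2.row < c then (1 : ℤ) else 0) + (if (ofLex x).2.col < c then 1 else 0)).sum := by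
    intro c
    refine sum_map_filter_le_eq hw ?_
    have := congrArg (fun S : Multiset (Idx n) => (S.map fun i => if i < c then (1 : ℤ) else 0).sum)
      hcont
    simp only [ColPart.content, Multiset.map_add, Multiset.sum_add, Multiset.map_map,
      Function.comp_def] at this
    simp only [Multiset.sum_map_add]
    linarith
  have hdeg : ((Ψ.filter (¬ z < ·)).map fun x =>
        (if (ofLex x).1 = (ofLex z).1 then (1 : ℤ) else 0)).sum =
      ((Φ.filter (¬ z < ·)).map fun x =>
        (if (ofLex x).1 = (ofLex z).1 then (1 : ℤ) else 0)).sum := by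
    refine sum_map_filter_le_eq hw ?_
    have := congrArg (fun S : Multiset ℤ => (S.map fun i => if i = (ofLex z).1 then (1 : ℤ) else 0).sum)
      hshape
    simpa only [Multiset.map_map, Function.comp_def] using this.symm
  -- the number of parts of the degree of `z` in the row of `z`
  have hrow : ((Φ.filter (¬ z < ·)).map fun x =>
        (if (ofLex x).1 = (ofLex z).1 ∧ (ofLex x).2.row = (ofLex z).2.row then (1 : ℤ) else 0)).sum ≤
      ((Ψ.filter (¬ z < ·)).map fun x =>
        (if (ofLex x).1 = (ofLex z).1 ∧ (ofLex x).2.row = (ofLex z).2.row then (1 : ℤ) else 0)).sum := by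
    have h1 := hidx (ofLex z).2.row
    -- In Φ, a part of the degree of z with a smaller row has its column at or above that of z, so
    -- it contributes exactly one index. Parts of smaller degree lie entirely at or above the column
    -- of z and contribute none.
    have h2 : ((Φ.filter (¬ z < ·)).map fun x =>
        (if (ofLex x).2.row < (ofLex z).2.row then (1 : ℤ) else 0) +
          (if (ofLex x).2.col < (ofLex z).2.row then 1 else 0)).sum ≤
        ((Φ.filter (¬ z < ·)).map fun x => (if (ofLex x).1 = (ofLex z).1 then (1 : ℤ) else 0) -
        (if (ofLex x).1 = (ofLex z).1 ∧ (ofLex x).2.row = (ofLex z).2.row then 1 else 0)).sum := by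
      refine Multiset.sum_map_le_sum_map _ _ fun x hx => ?_
      rw [Multiset.mem_filter, Part.not_lt_iff] at hx
      have h3 := hΦ.nested x hx.1 z hzΦ
      have h4 := hΦ.separated z hzΦ x hx.1
      have h5 := (ofLex z).2.row_le_col
      have h6 := (ofLex x).2.row_le_col
      grind
    have h3 : ((Ψ.filter (¬ z < ·)).map fun x =>
        (if (ofLex x).1 = (ofLex z).1 then (1 : ℤ) else 0) -
        (if (ofLex x).1 = (ofLex z).1 ∧ (ofLex x).2.row = (ofLex z).2.row then 1 else 0)).sum ≤
        ((Ψ.filter (¬ z < ·)).map fun x =>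
        (if (ofLex x).2.row < (ofLex z).2.row then (1 : ℤ) else 0) +
          (if (ofLex x).2.col < (ofLex z).2.row then 1 else 0)).sum := by
      refine Multiset.sum_map_le_sum_map _ _ fun x hx => ?_
      rw [Multiset.mem_filter, Part.not_lt_iff] at hx
      grind
    rw [Multiset.sum_map_sub] at h2 h3
    linarith
  -- If row and column of z coincide, a part not above z with the degree and row of z must be z
  -- itself, so the row count is already the multiplicity of z.
  rcases (ofLex z).2.row_le_col.eq_or_lt with hd | hd
  · have h1 : ∀ S : ColPart n, (S.filter (¬ z < ·)).map (fun x =>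
        (if (ofLex x).1 = (ofLex z).1 ∧ (ofLex x).2.row = (ofLex z).2.row then (1 : ℤ) else 0)) =
        (S.filter (¬ z < ·)).map fun x => if x = z then (1 : ℤ) else 0 := by
      intro S
      refine Multiset.map_congr rfl fun x hx => ?_
      rw [Multiset.mem_filter, Part.not_lt_iff] at hx
      have h6 := (ofLex x).2.row_le_col
      have h7 := Part.ext_iff (x := x) (z := z)
      grind
    rw [h1, h1, hcount, hcount] at hrow
    omega
  -- Otherwise a part in the row of z has its row index below the column of z, and its column index
  -- too unless the part is z; this makes the multiplicity of z visible.
  · have h1 := hidx (ofLex z).2.col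
    have h2 : ((Φ.filter (¬ z < ·)).map fun x =>
        (if (ofLex x).2.row < (ofLex z).2.col then (1 : ℤ) else 0) +
          (if (ofLex x).2.col < (ofLex z).2.col then 1 else 0)).sum ≤
        ((Φ.filter (¬ z < ·)).map fun x => (if (ofLex x).1 = (ofLex z).1 then (1 : ℤ) else 0) +
        (if (ofLex x).1 = (ofLex z).1 ∧ (ofLex x).2.row = (ofLex z).2.row then 1 else 0) -
        (if x = z then 1 else 0)).sum := by
      refine Multiset.sum_map_le_sum_map _ _ fun x hx => ?_
      rw [Multiset.mem_filter, Part.not_lt_iff] at hx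
      have h3 := hΦ.nested x hx.1 z hzΦ
      have h4 := hΦ.separated z hzΦ x hx.1
      have h6 := (ofLex x).2.row_le_col
      have h7 := Part.ext_iff (x := x) (z := z)
      grind
    have h3 : ((Ψ.filter (¬ z < ·)).map fun x =>
        (if (ofLex x).1 = (ofLex z).1 then (1 : ℤ) else 0) +
        (if (ofLex x).1 = (ofLex z).1 ∧ (ofLex x).2.row = (ofLex z).2.row then 1 else 0) -
        (if x = z then 1 else 0)).sum ≤
        ((Ψ.filter (¬ z < ·)).map fun x =>
        (if (ofLex x).2.row < (ofLex z).2.col then (1 : ℤ) else 0) +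
          (if (ofLex x).2.col < (ofLex z).2.col then 1 else 0)).sum := by
      refine Multiset.sum_map_le_sum_map _ _ fun x hx => ?_
      rw [Multiset.mem_filter, Part.not_lt_iff] at hx
      have h7 := Part.ext_iff (x := x) (z := z)
      grind
    simp only [Multiset.sum_map_sub, Multiset.sum_map_add, hcount] at h1 h2 h3
    have : (Ψ.count z : ℤ) < Φ.count z := by exact_mod_cast hz
    linarith

theorem ColPart.shape_pairwise {n : ℕ} (Φ : ColPart n) : Φ.shape.Pairwise (· ≥ ·) := by
  rw [ColPart.shape, List.pairwise_map]
  refine (Multiset.pairwise_sort Φ (· ≥ ·)).imp fun {x y} h => ?_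
  rcases Prod.Lex.le_iff.1 h with h | h
  · exact h.le
  · exact h.1.le

theorem ColPart.coe_shape {n : ℕ} (Φ : ColPart n) :
    (Φ.shape : Multiset ℤ) = Φ.map fun q => (ofLex q).1 := by
  rw [ColPart.shape, ← Multiset.map_coe, Multiset.sort_eq]

theorem ColPart.sum_shape {n : ℕ} (Φ : ColPart n) : Φ.shape.sum = Φ.degree := by
  rw [← Multiset.sum_coe, ColPart.coe_shape, ColPart.degree]

theorem ColPart.eq_or_prec {n : ℕ} {Φ Ψ : ColPart n} (hcard : Φ.card = Ψ.card)
    (hdeg : Φ.degree = Ψ.degree) {e : ℤ} (he : ∀ x ∈ Φ, (ofLex x).1 = e ∨ (ofLex x).1 = e - 1)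
    (h : Φ.map (fun q => (ofLex q).1) = Ψ.map (fun q => (ofLex q).1) →
      ¬ List.Lex (· < ·) (Ψ.sort (· ≥ ·)) (Φ.sort (· ≥ ·))) :
    Ψ = Φ ∨ ColPart.Prec Φ Ψ := by
  rcases lt_trichotomy Φ.shape Ψ.shape with hs | hs | hs
  · exact Or.inr (Or.inr ⟨hcard, Or.inr ⟨hdeg, Or.inl hs⟩⟩)
  · have hm : Φ.map (fun q => (ofLex q).1) = Ψ.map (fun q => (ofLex q).1) := by
      rw [← ColPart.coe_shape, ← ColPart.coe_shape, hs]
    rcases lt_trichotomy (Φ.sort (· ≥ ·)) (Ψ.sort (· ≥ ·)) with hk | hk | hk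
    · exact Or.inr (Or.inr ⟨hcard, Or.inr ⟨hdeg, Or.inr ⟨hs, lex_map_snd hk hs⟩⟩⟩)
    · left
      rw [← Multiset.sort_eq Ψ (· ≥ ·), ← hk, Multiset.sort_eq]
    · exact absurd hk (h hm)
  · exfalso
    have hl : Ψ.shape.length = Φ.shape.length := by
      simp [ColPart.shape, hcard]
    have := sum_lt_sum_of_lex hs Ψ.shape_pairwise hl (by
      have : ∀ x ∈ Φ.shape, x = e ∨ x = e - 1 := by
        intro x hx
        rw [← Multiset.mem_coe, ColPart.coe_shape, Multiset.mem_map] at hx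
        obtain ⟨y, hy, rfl⟩ := hx
        exact he y hy
      intro x hx y hy
      rcases this x hx with h1 | h1 <;> rcases this y hy with h2 | h2 <;> omega)
    rw [ColPart.sum_shape, ColPart.sum_shape] at this
    omega

/-- The colored partition with given degrees and places. -/
def ColPart.ofFun {n l : ℕ} (d : Fin l → ℤ) (p : Fin l → Place n) : ColPart n :=
  Finset.univ.val.map fun t => part (d t) (p t)

theorem ColPart.card_ofFun {n l : ℕ} (d : Fin l → ℤ) (p : Fin l → Place n) :
    (ColPart.ofFun d p).card = l := by simp [ColPart.ofFun]

theorem ColPart.degrees_ofFun {n l : ℕ} (d : Fin l → ℤ) (p : Fin l → Place n) :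
    (ColPart.ofFun d p).map (fun q => (ofLex q).1) = Finset.univ.val.map d := by
  rw [ColPart.ofFun, Multiset.map_map]
  rfl

theorem ColPart.degree_ofFun {n l : ℕ} (d : Fin l → ℤ) (p : Fin l → Place n) :
    (ColPart.ofFun d p).degree = ∑ t, d t := by
  rw [ColPart.degree, ColPart.degrees_ofFun]
  rfl

theorem part_le_part {n : ℕ} {d : ℤ} {p q : Place n} (h : p ≤ q) : part d p ≤ part d q :=
  Prod.Lex.le_iff.2 (Or.inr ⟨rfl, h⟩)

theorem part_injective {n : ℕ} {d d' : ℤ} {p q : Place n} (h : part d p = part d' q) :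
    d = d' ∧ p = q := Prod.mk.inj (toLex.injective h)

/-- When the shapes agree, the sorted lists satisfy Φ ≤ `p` by nesting and `p` ≤ `q` by
triangularity. Equality of the ends collapses the chain, so Φ can arise only from diagonal
coefficients. -/
theorem ColPart.IsNested.ofFun_eq_or_prec {n l : ℕ} {Φ : ColPart n} (hΦ : Φ.IsNested) {e : ℤ}
    (he : ∀ x ∈ Φ, (ofLex x).1 = e ∨ (ofLex x).1 = e - 1) {d : Fin l → ℤ}
    {p q : Fin l → Place n} (hpq : ∀ t, p t ≤ q t) (hcard : Φ.card = l)
    (hdeg : Φ.degree = ∑ t, d t) (hcont : Φ.content = (ColPart.ofFun d p).content) :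
    (ColPart.ofFun d q = Φ → p = q) ∧
      (ColPart.ofFun d q = Φ ∨ ColPart.Prec Φ (ColPart.ofFun d q)) := by
  have hle : ¬ List.Lex (· < ·) ((ColPart.ofFun d q).sort (· ≥ ·))
      ((ColPart.ofFun d p).sort (· ≥ ·)) := not_sort_lex_of_le fun t => part_le_part (hpq t)
  constructor
  · intro h
    rw [h] at hle
    have h2 := hΦ.not_sort_lex (Ψ := ColPart.ofFun d p)
      (by rw [← h, ColPart.degrees_ofFun, ColPart.degrees_ofFun]) hcont
    have h3 : Φ.sort (· ≥ ·) = (ColPart.ofFun d p).sort (· ≥ ·) :=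
      le_antisymm (not_lt.1 h2) (not_lt.1 hle)
    have h4 : ColPart.ofFun d p = ColPart.ofFun d q := by
      rw [h, ← Multiset.sort_eq Φ (· ≥ ·), h3, Multiset.sort_eq]
    have h5 := eq_of_le_of_map_eq (fun t => part_le_part (hpq t)) h4
    funext t
    exact (part_injective (congrFun h5 t)).2
  · refine ColPart.eq_or_prec (by rw [hcard, ColPart.card_ofFun])
      (by rw [hdeg, ColPart.degree_ofFun]) he fun hs hlt => ?_
    have h2 := hΦ.not_sort_lex (Ψ := ColPart.ofFun d p)
      (by rw [hs, ColPart.degrees_ofFun, ColPart.degrees_ofFun]) hcont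
    exact hle (lt_of_lt_of_le (α := List (Part n)) hlt (not_lt.1 h2))

/-! ### Colored partitions of cascades -/

theorem mem_cascadeMonomial {n : ℕ} {j : ℤ} {C : List (Place n)} {m : Place n → ℕ} {x : Part n} :
    x ∈ cascadeMonomial j C m ↔ ∃ p ∈ C, m p ≠ 0 ∧ x = part j p := by
  induction C with
  | nil => simp [cascadeMonomial]
  | cons p C ih =>
    rw [cascadeMonomial, List.map_cons, List.sum_cons, Multiset.mem_add, Multiset.mem_replicate]
    rw [cascadeMonomial] at ih
    rw [ih]
    simp

theorem card_cascadeMonomial {n : ℕ} (j : ℤ) (C : List (Place n)) (m : Place n → ℕ) :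
    (cascadeMonomial j C m).card = (C.map m).sum := by
  induction C with
  | nil => simp [cascadeMonomial]
  | cons p C ih =>
    rw [cascadeMonomial] at ih ⊢
    simp [ih]

/-- Each step of a cascade enlarges the interval from row to column. -/
theorem IsCascade.nested {n : ℕ} {C : List (Place n)} (hC : IsCascade C) {p q : Place n}
    (hp : p ∈ C) (hq : q ∈ C) :
    (p.row ≤ q.row ∧ q.col ≤ p.col) ∨ (q.row ≤ p.row ∧ p.col ≤ q.col) := by
  have h1 : C.IsChain fun p q => q.row ≤ p.row ∧ p.col ≤ q.col :=
    hC.imp fun p q h => by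
      rcases h with h | h
      · exact ⟨h.1.le, h.2.ge⟩
      · exact ⟨h.1.le, h.2.le⟩
  have : IsTrans (Place n) fun p q => q.row ≤ p.row ∧ p.col ≤ q.col :=
    ⟨fun p q r h h' => ⟨h'.1.trans h.1, h.2.trans h'.2⟩⟩
  have h2 := List.isChain_iff_pairwise.1 h1
  exact List.Pairwise.forall_of_forall_of_flip
    (R := fun p q : Place n => (p.row ≤ q.row ∧ q.col ≤ p.col) ∨ (q.row ≤ p.row ∧ p.col ≤ q.col))
    (fun x _ => Or.inl ⟨le_rfl, le_rfl⟩) (h2.imp Or.inr) (h2.imp Or.inl) hp hq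

theorem isNested_cascadeMonomial {n : ℕ} {j : ℤ} {r : Idx n} {B A : List (Place n)}
    {mB mA : Place n → ℕ} (hB : IsCascade B) (hA : IsCascade A)
    (hBr : ∀ β ∈ B, mB β ≠ 0 → β ∈ upperTriangle r)
    (hAr : ∀ α ∈ A, mA α ≠ 0 → α ∈ lowerTriangle r) :
    (cascadeMonomial (-j - 1) B mB + cascadeMonomial (-j) A mA).IsNested where
  nested := by
    intro x hx y hy hxy
    rw [Multiset.mem_add, mem_cascadeMonomial, mem_cascadeMonomial] at hx hy
    rcases hx with ⟨p, hp, _, rfl⟩ | ⟨p, hp, _, rfl⟩ <;>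
      rcases hy with ⟨q, hq, _, rfl⟩ | ⟨q, hq, _, rfl⟩
    · exact hB.nested hp hq
    · simp only [part, ofLex_toLex] at hxy; omega
    · simp only [part, ofLex_toLex] at hxy; omega
    · exact hA.nested hp hq
  separated := by
    intro x hx y hy hxy
    rw [Multiset.mem_add, mem_cascadeMonomial, mem_cascadeMonomial] at hx hy
    rcases hx with ⟨p, hp, hp0, rfl⟩ | ⟨p, hp, hp0, rfl⟩ <;>
      rcases hy with ⟨q, hq, hq0, rfl⟩ | ⟨q, hq, hq0, rfl⟩ <;>
      simp only [part, ofLex_toLex] at hxy ⊢ <;> try omega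
    exact le_trans (hAr p hp hp0) (hBr q hq hq0)

/-! ### Ordering of products -/

/-- The product of the elements `X_{ab}(j)` in the order of a list. -/
def wordProd {n : ℕ} (k : ℕ) (X : Place n → SpAlg n) (L : List (Part n)) : LevelAlg n k :=
  (L.map fun q => gen k (X (ofLex q).2) (ofLex q).1).prod

theorem wordProd_cons {n : ℕ} (k : ℕ) (X : Place n → SpAlg n) (q : Part n) (L : List (Part n)) :
    wordProd k X (q :: L) = gen k (X (ofLex q).2) (ofLex q).1 * wordProd k X L := by
  simp [wordProd]

theorem monomial_eq_wordProd {n : ℕ} (k : ℕ) (X : Place n → SpAlg n) (Φ : ColPart n) :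
    monomial k X Φ = wordProd k X (Φ.sort (· ≤ ·)) := rfl

/-- If `N` is nonnegative, then the last factor of the word has degree at least `N`. -/
def LastGE {n : ℕ} (N : ℤ) (L : List (Part n)) : Prop :=
  0 ≤ N → ∃ L' q, L = L' ++ [q] ∧ N ≤ (ofLex q).1

theorem LastGE.cons {n : ℕ} {N : ℤ} {L : List (Part n)} (h : LastGE N L) (q : Part n) :
    LastGE N (q :: L) := by
  intro hN
  obtain ⟨L', p, rfl, hp⟩ := h hN
  exact ⟨q :: L', p, rfl, hp⟩

theorem lastGE_cons_cons {n : ℕ} {N : ℤ} {L : List (Part n)} {p q : Part n} :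
    LastGE N (p :: q :: L) ↔ LastGE N (q :: L) := by
  refine ⟨fun h hN => ?_, fun h => h.cons p⟩
  obtain ⟨L', r, h', hr⟩ := h hN
  rcases L' with - | ⟨s, L'⟩
  · simp at h'
  · exact ⟨L', r, (List.cons.inj h').2, hr⟩

theorem lastGE_singleton {n : ℕ} {N : ℤ} {q : Part n} :
    LastGE N [q] ↔ (0 ≤ N → N ≤ (ofLex q).1) := by
  refine forall_congr' fun _ => ⟨?_, fun h => ⟨[], q, rfl, h⟩⟩
  rintro ⟨L', r, h', hr⟩
  rcases L' with - | ⟨s, L'⟩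
  · obtain rfl : q = r := by simpa using h'
    exact hr
  · simp at h'

/-- The span of the words of length at most `l` with last degree at least `N`. -/
def wordSpan {n : ℕ} (k : ℕ) (X : Place n → SpAlg n) (l : ℕ) (N : ℤ) :
    Submodule ℂ (LevelAlg n k) :=
  Submodule.span ℂ {u | ∃ L : List (Part n), L.length ≤ l ∧ LastGE N L ∧ u = wordProd k X L}

/-- The span of the ordered monomials of length at most `l` which contain, if `N` is nonnegative,
a part of degree at least `N`. -/
def monomialSpan {n : ℕ} (k : ℕ) (X : Place n → SpAlg n) (l : ℕ) (N : ℤ) :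
    Submodule ℂ (LevelAlg n k) :=
  Submodule.span ℂ {u | ∃ Ψ : ColPart n, Ψ.card ≤ l ∧ (0 ≤ N → ∃ q ∈ Ψ, N ≤ (ofLex q).1) ∧
    u = monomial k X Ψ}

section

variable {n : ℕ} {k : ℕ} {X : Place n → SpAlg n}

theorem wordProd_mem_wordSpan {l : ℕ} {N : ℤ} {L : List (Part n)} (hl : L.length ≤ l)
    (hN : LastGE N L) : wordProd k X L ∈ wordSpan k X l N :=
  Submodule.subset_span ⟨L, hl, hN, rfl⟩

theorem wordSpan_mono {l l' : ℕ} (h : l ≤ l') (N : ℤ) : wordSpan k X l N ≤ wordSpan k X l' N :=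
  Submodule.span_mono fun _ ⟨L, hl, hN, hu⟩ => ⟨L, hl.trans h, hN, hu⟩

theorem monomialSpan_mono {l l' : ℕ} (h : l ≤ l') (N : ℤ) :
    monomialSpan k X l N ≤ monomialSpan k X l' N :=
  Submodule.span_mono fun _ ⟨L, hl, hN, hu⟩ => ⟨L, hl.trans h, hN, hu⟩

theorem gen_mul_mem_wordSpan {l : ℕ} {N : ℤ} {u : LevelAlg n k} (q : Part n)
    (hu : u ∈ wordSpan k X l N) :
    gen k (X (ofLex q).2) (ofLex q).1 * u ∈ wordSpan k X (l + 1) N := by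
  induction hu using Submodule.span_induction with
  | mem u hu =>
    obtain ⟨L, hl, hN, rfl⟩ := hu
    rw [← wordProd_cons]
    exact wordProd_mem_wordSpan (by simpa) (hN.cons q)
  | zero => rw [mul_zero]; exact zero_mem _
  | add u v _ _ hu hv => rw [mul_add]; exact add_mem hu hv
  | smul c u _ hu => rw [mul_smul_comm]; exact Submodule.smul_mem _ _ hu

theorem gen_sum {ι : Type*} (s : Finset ι) (f : ι → SpAlg n) (i : ℤ) :
    gen k (∑ x ∈ s, f x) i = ∑ x ∈ s, gen k (f x) i := by
  classical
  induction s using Finset.induction_on with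
  | empty =>
    rw [Finset.sum_empty, Finset.sum_empty, ← zero_smul ℂ (0 : SpAlg n), gen_smul, zero_smul]
  | insert a s ha ih => rw [Finset.sum_insert ha, Finset.sum_insert ha, gen_add, ih]

/-- A swap costs a commutator, which is shorter. Sorting only moves a larger part to the right. If
the pair ends the word and N ≥ 0, both degrees are at least N, hence so is the degree of the
bracket. -/
theorem wordProd_swap_sub_mem (hX : IsTriangularBasis X) {p q : Part n} (hpq : p ≤ q) {N : ℤ}
    {L : List (Part n)} (hN : LastGE N (p :: L)) :
    wordProd k X (q :: p :: L) - wordProd k X (p :: q :: L) ∈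
      wordSpan k X (L.length + 1) N := by
  obtain ⟨g, hg⟩ := hX.exists_eq_sum ⁅X (ofLex q).2, X (ofLex p).2⁆
  have hdeg : (ofLex p).1 ≤ (ofLex q).1 := by
    rcases Prod.Lex.le_iff.1 hpq with h | h
    · exact h.le
    · exact h.1.le
  simp only [wordProd_cons]
  rw [← mul_assoc, ← mul_assoc, ← sub_mul, gen_comm, add_mul, hg, gen_sum, Finset.sum_mul]
  refine add_mem (Submodule.sum_mem _ fun r _ => ?_) ?_
  · rw [gen_smul, smul_mul_assoc]
    refine Submodule.smul_mem _ _ ?_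
    refine Submodule.subset_span ⟨part ((ofLex q).1 + (ofLex p).1) r :: L, by simp, ?_, ?_⟩
    · rcases L with - | ⟨s, L⟩
      · rw [lastGE_singleton] at hN ⊢
        intro h0
        have := hN h0
        simp only [part, ofLex_toLex]
        omega
      · exact (lastGE_cons_cons.1 hN).cons _
    · rw [wordProd_cons]; rfl
  · rw [← Algebra.smul_def]
    rcases L with - | ⟨s, L⟩
    · rw [lastGE_singleton] at hN
      by_cases h0 : 0 ≤ N
      · have h1 := hN h0
        -- Two nonnegative degrees with sum zero both vanish, and the cocycle carries the degree as
        -- a factor, so no central term destroys the bound on the last factor.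
        have : (if (ofLex q).1 + (ofLex p).1 = 0 then
            (((ofLex q).1 : ℤ) : ℂ) * form n (X (ofLex q).2) (X (ofLex p).2) else 0) = 0 := by
          split_ifs with h
          · have : (ofLex q).1 = 0 := by omega
            rw [this]; simp
          · rfl
        rw [this, zero_mul, zero_smul]
        exact zero_mem _
      · exact Submodule.smul_mem _ _ (wordProd_mem_wordSpan (by simp) fun h => absurd h h0)
    · exact Submodule.smul_mem _ _ (wordProd_mem_wordSpan (by simp) (lastGE_cons_cons.1 hN))

/-- The empty tail is exempted because the empty word has no last factor, and so fails `LastGE` for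
nonnegative N. -/
theorem wordProd_orderedInsert_sub_mem (hX : IsTriangularBasis X) (q : Part n) {N : ℤ}
    {L : List (Part n)} (hN : LastGE N (q :: L)) (hL : L ≠ [] → LastGE N L) :
    wordProd k X (q :: L) - wordProd k X (L.orderedInsert (· ≤ ·) q) ∈
        wordSpan k X L.length N ∧ LastGE N (L.orderedInsert (· ≤ ·) q) := by
  induction L with
  | nil => simpa using hN
  | cons p L ih =>
    rw [List.orderedInsert_cons]
    split_ifs with hqp
    · exact ⟨by rw [sub_self]; exact zero_mem _, hN⟩
    · have hpq : p ≤ q := (not_le.1 hqp).le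
      have hp : LastGE N (p :: L) := hL (by simp)
      have hqL : LastGE N (q :: L) := by
        rcases L with - | ⟨s, L⟩
        · rw [lastGE_singleton] at hp ⊢
          intro h0
          refine (hp h0).trans ?_
          rcases Prod.Lex.le_iff.1 hpq with h | h
          · exact h.le
          · exact h.1.le
        · exact (lastGE_cons_cons.1 hp).cons _
      obtain ⟨h1, h2⟩ := ih hqL (by
        intro hne
        rcases L with - | ⟨s, L⟩
        · exact absurd rfl hne
        · exact lastGE_cons_cons.1 hp)
      refine ⟨?_, h2.cons p⟩
      have h3 := add_mem (wordProd_swap_sub_mem (k := k) hX hpq hp) (gen_mul_mem_wordSpan p h1)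
      rw [mul_sub, ← wordProd_cons, ← wordProd_cons, sub_add_sub_cancel] at h3
      exact h3

theorem wordProd_insertionSort_sub_mem (hX : IsTriangularBasis X) {N : ℤ} (L : List (Part n))
    (hN : LastGE N L) :
    wordProd k X L - wordProd k X (L.insertionSort (· ≤ ·)) ∈ wordSpan k X (L.length - 1) N ∧
      LastGE N (L.insertionSort (· ≤ ·)) := by
  induction L with
  | nil => exact ⟨by simp, hN⟩
  | cons q L ih =>
    rw [List.insertionSort_cons]
    rcases L with - | ⟨p, L⟩
    · simpa using hN
    · obtain ⟨h1, h2⟩ := ih (lastGE_cons_cons.1 hN)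
      obtain ⟨h3, h4⟩ := wordProd_orderedInsert_sub_mem (k := k) hX q (h2.cons q) fun _ => h2
      refine ⟨?_, h4⟩
      rw [List.length_insertionSort] at h3
      have h5 := add_mem (gen_mul_mem_wordSpan q h1) h3
      rw [mul_sub, ← wordProd_cons, ← wordProd_cons, sub_add_sub_cancel] at h5
      exact h5

theorem insertionSort_eq_sort {α : Type*} [LinearOrder α] (L : List α) :
    L.insertionSort (· ≤ ·) = (L : Multiset α).sort (· ≤ ·) := by
  refine List.Perm.eq_of_pairwise' (r := (· ≤ ·)) (List.pairwise_insertionSort _ _)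
    (Multiset.pairwise_sort _ _) ?_
  refine (List.perm_insertionSort _ _).trans ?_
  rw [← Multiset.coe_eq_coe, Multiset.sort_eq]

theorem wordProd_sub_monomial_mem_wordSpan (hX : IsTriangularBasis X) {N : ℤ} (L : List (Part n))
    (hN : LastGE N L) :
    wordProd k X L - monomial k X (L : Multiset (Part n)) ∈ wordSpan k X (L.length - 1) N := by
  rw [monomial_eq_wordProd, ← insertionSort_eq_sort]
  exact (wordProd_insertionSort_sub_mem hX L hN).1

theorem LastGE.exists_mem {N : ℤ} {L : List (Part n)} (h : LastGE N L) (h0 : 0 ≤ N) :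
    ∃ q ∈ (L : Multiset (Part n)), N ≤ (ofLex q).1 := by
  obtain ⟨L', q, rfl, hq⟩ := h h0
  exact ⟨q, by simp, hq⟩

theorem wordSpan_le_monomialSpan (hX : IsTriangularBasis X) (l : ℕ) (N : ℤ) :
    wordSpan k X l N ≤ monomialSpan k X l N := by
  induction l with
  | zero =>
    refine Submodule.span_mono ?_
    rintro _ ⟨L, hl, hN, rfl⟩
    obtain rfl : L = [] := by simpa using hl
    exact ⟨0, by simp, hN.exists_mem, by simp [wordProd, monomial]⟩
  | succ l ih =>
    refine Submodule.span_le.2 ?_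
    rintro _ ⟨L, hl, hN, rfl⟩
    rw [← sub_add_cancel (wordProd k X L) (monomial k X (L : Multiset (Part n)))]
    refine add_mem ?_ (Submodule.subset_span ⟨_, by simpa, hN.exists_mem, rfl⟩)
    exact monomialSpan_mono (Nat.le_succ l) N (ih (wordSpan_mono (by omega) N
      (wordProd_sub_monomial_mem_wordSpan hX L hN)))

/-- Reordering a product changes it by a combination of shorter monomials. -/
theorem wordProd_sub_monomial_mem (hX : IsTriangularBasis X) {N : ℤ} (L : List (Part n))
    (hN : LastGE N L) :
    wordProd k X L - monomial k X (L : Multiset (Part n)) ∈ monomialSpan k X (L.length - 1) N :=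
  wordSpan_le_monomialSpan hX _ N (wordProd_sub_monomial_mem_wordSpan hX L hN)

theorem wordProd_mem_leftIdeal {N : ℕ} {L : List (Part n)} (h : LastGE N L) :
    wordProd k X L ∈ leftIdeal n k N := by
  obtain ⟨L', q, rfl, hq⟩ := h (by positivity)
  rw [wordProd, List.map_append, List.prod_append]
  refine (leftIdeal n k N).smul_mem _ (Submodule.subset_span ?_)
  exact ⟨X (ofLex q).2, (ofLex q).1, hq, by simp⟩

/-- Factors ascend, so the rightmost one has the largest degree. -/
theorem monomial_mem_leftIdeal {N : ℕ} {Ψ : ColPart n} (h : ∃ q ∈ Ψ, (N : ℤ) ≤ (ofLex q).1) :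
    monomial k X Ψ ∈ leftIdeal n k N := by
  rw [monomial_eq_wordProd]
  refine wordProd_mem_leftIdeal fun _ => ?_
  obtain ⟨q, hq, hqN⟩ := h
  have hq' : q ∈ Ψ.sort (· ≤ ·) := by simpa using hq
  have hne : Ψ.sort (· ≤ ·) ≠ [] := List.ne_nil_of_mem hq'
  refine ⟨_, _, (List.dropLast_append_getLast hne).symm, hqN.trans ?_⟩
  have hs := Multiset.pairwise_sort Ψ (· ≤ ·)
  rw [← List.dropLast_append_getLast hne] at hq' hs
  rcases List.mem_append.1 hq' with h | h
  · have := (List.pairwise_append.1 hs).2.2 q h _ (List.mem_singleton_self _)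
    rcases Prod.Lex.le_iff.1 this with h | h
    · exact h.le
    · exact h.1.le
  · rw [List.mem_singleton.1 h]

end

/-! ### Symmetrized products and the adjoint action -/

/-- Commutation with an element is a derivation of ordered products. -/
theorem mul_ofFn_prod_sub {A : Type*} [Ring A] (u : A) {l : ℕ} (f : Fin l → A) :
    u * (List.ofFn f).prod - (List.ofFn f).prod * u =
      ∑ t, (List.ofFn (Function.update f t (u * f t - f t * u))).prod := by
  induction l with
  | zero => simp
  | succ l ih =>
    have h := ih (fun t => f t.succ)
    rw [Fin.sum_univ_succ]
    simp only [List.ofFn_succ, List.prod_cons, Function.update_self]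
    have h0 : ∀ v, (fun t : Fin l => Function.update f 0 v t.succ) = fun t => f t.succ := by
      intro v
      funext t
      exact Function.update_of_ne (Fin.succ_ne_zero t) _ _
    have h1 : ∀ (s : Fin l) v, (fun t : Fin l => Function.update f s.succ v t.succ) =
        Function.update (fun t => f t.succ) s v := by
      intro s v
      funext t
      by_cases hst : t = s
      · subst hst; simp
      · rw [Function.update_of_ne hst, Function.update_of_ne]
        exact fun h => hst (Fin.succ_injective _ h)
    have h2 : ∀ (s : Fin l) v, Function.update f s.succ v 0 = f 0 := fun s v =>
      Function.update_of_ne (Fin.succ_ne_zero s).symm _ _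
    simp only [h0, h1, h2]
    rw [← Finset.mul_sum, ← h]
    noncomm_ring

theorem map_update_univ {ι α : Type*} [Fintype ι] [DecidableEq ι] [DecidableEq α] (w : ι → α)
    (s : ι) (y : α) :
    (Finset.univ.val.map (Function.update w s y) : Multiset α) =
      y ::ₘ (Finset.univ.val.map w).erase (w s) := by
  have h : (Finset.univ : Finset ι).val = s ::ₘ (Finset.univ.erase s).val := by
    rw [← Finset.insert_val_of_notMem (Finset.notMem_erase s _),
      Finset.insert_erase (Finset.mem_univ s)]
  rw [h, Multiset.map_cons, Multiset.map_cons, Multiset.erase_cons_head, Function.update_self]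
  congr 1
  refine Multiset.map_congr rfl fun t ht => Function.update_of_ne ?_ _ _
  exact Finset.ne_of_mem_erase ht

/-- Replacing one value `x` by `y` in all possible ways in all functions with given multiset of
values. -/
theorem sum_update_eq {ι α M : Type*} [Fintype ι] [DecidableEq ι] [Fintype α] [DecidableEq α]
    [AddCommMonoid M] (F : (ι → α) → M) (c : Multiset α) (x y : α) :
    (∑ w : ι → α with Finset.univ.val.map w = c,
        ∑ s, if w s = x then F (Function.update w s y) else 0) =
      if x ∈ c then (y ::ₘ c.erase x).count y •
        ∑ w : ι → α with Finset.univ.val.map w = y ::ₘ c.erase x, F w else 0 := by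
  split_ifs with hx
  · rw [Finset.sum_comm]
    have h1 : ∀ s : ι, (∑ w : ι → α with Finset.univ.val.map w = c,
        if w s = x then F (Function.update w s y) else 0) =
        ∑ w : ι → α with Finset.univ.val.map w = y ::ₘ c.erase x,
          if w s = y then F w else 0 := by
      intro s
      rw [← Finset.sum_filter, ← Finset.sum_filter]
      -- For a fixed position the replacement is reversible; each resulting word is then reached
      -- once for every occurrence of `y` in it.
      refine Finset.sum_bij' (fun w _ => Function.update w s y) (fun w _ => Function.update w s x)
        ?_ ?_ ?_ ?_ ?_
      · intro w hw
        simp only [Finset.mem_filter, Finset.mem_univ, true_and, map_update_univ] at hw ⊢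
        rw [hw.1, hw.2]
        exact ⟨rfl, Function.update_self _ _ _⟩
      · intro w hw
        simp only [Finset.mem_filter, Finset.mem_univ, true_and, map_update_univ] at hw ⊢
        rw [hw.1, hw.2, Multiset.erase_cons_head, Multiset.cons_erase hx]
        exact ⟨rfl, Function.update_self _ _ _⟩
      · intro w hw
        simp only [Finset.mem_filter, Finset.mem_univ, true_and] at hw
        rw [Function.update_idem, ← hw.2, Function.update_eq_self]
      · intro w hw
        simp only [Finset.mem_filter, Finset.mem_univ, true_and] at hw
        rw [Function.update_idem, ← hw.2, Function.update_eq_self]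
      · intro w _
        rfl
    rw [Finset.sum_congr rfl fun s _ => h1 s, Finset.sum_comm, Finset.smul_sum]
    refine Finset.sum_congr rfl fun w hw => ?_
    rw [← Finset.sum_filter, Finset.sum_const, ← (Finset.mem_filter.1 hw).2, Multiset.count_map]
    congr 1
    simp only [eq_comm (a := y)]
    rfl
  · refine Finset.sum_eq_zero fun w hw => Finset.sum_eq_zero fun s _ => if_neg fun h => hx ?_
    rw [← (Finset.mem_filter.1 hw).2, ← h]
    exact Multiset.mem_map_of_mem _ (Finset.mem_univ s)

/-- The ordered product of the elements labelled by the pairs of indices of a word, with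
degrees `d`. -/
def pairProd {n : ℕ} (k : ℕ) {l : ℕ} (d : Fin l → ℤ) (w : Fin l × Bool → Idx n) : LevelAlg n k :=
  (List.ofFn fun t => gen k (symBasis (w (t, false)) (w (t, true))) (d t)).prod

theorem pairProd_update_false {n k l : ℕ} (d : Fin l → ℤ) (w : Fin l × Bool → Idx n) (t : Fin l)
    (a : Idx n) :
    pairProd k d (Function.update w (t, false) a) =
      (List.ofFn (Function.update (fun t => gen k (symBasis (w (t, false)) (w (t, true))) (d t)) t
        (gen k (symBasis a (w (t, true))) (d t)))).prod := by
  rw [pairProd]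
  congr 2
  funext s
  by_cases h : s = t
  · subst h; simp
  · simp [h]

theorem pairProd_update_true {n k l : ℕ} (d : Fin l → ℤ) (w : Fin l × Bool → Idx n) (t : Fin l)
    (a : Idx n) :
    pairProd k d (Function.update w (t, true) a) =
      (List.ofFn (Function.update (fun t => gen k (symBasis (w (t, false)) (w (t, true))) (d t)) t
        (gen k (symBasis (w (t, false)) a) (d t)))).prod := by
  rw [pairProd]
  congr 2
  funext s
  by_cases h : s = t
  · subst h; simp
  · simp [h]

theorem gen_zero {n : ℕ} (k : ℕ) (i : ℤ) : gen k (0 : SpAlg n) i = 0 := by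
  rw [← zero_smul ℂ (0 : SpAlg n), gen_smul, zero_smul]

theorem gen_zero_comm {n : ℕ} (k : ℕ) (x y : SpAlg n) (j : ℤ) :
    gen k x 0 * gen k y j - gen k y j * gen k x 0 = gen k ⁅x, y⁆ j := by
  rw [gen_comm]
  simp

/-- On the vector representation e_a e_{o̲} sends e_o to a multiple of e_a and e_{a̲} to a multiple
of e_{o̲}. It serves as the operator replacing the index o by a. -/
theorem lie_symBasis {n : ℕ} (o a c d : Idx n) :
    ⁅symBasis a o.bar, symBasis c d⁆ =
      ((if c = o then o.sign • symBasis a d else 0) +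
        (if c = a.bar then a.bar.sign • symBasis o.bar d else 0)) +
      ((if d = o then o.sign • symBasis c a else 0) +
        (if d = a.bar then a.bar.sign • symBasis c o.bar else 0)) := by
  have h : ∀ c d : Idx n, symProd ((symBasis a o.bar).val.mulVec c.vec) d.vec =
      (if c = o then o.sign • symBasis a d else 0) +
        (if c = a.bar then a.bar.sign • symBasis o.bar d else 0) := by
    intro c d
    rw [symBasis_mulVec_vec, symProd_smul_left, symProd_add_left, symProd_smul_left,
      symProd_smul_left, smul_add]
    congr 1
    · by_cases hc : c = o
      · subst hc; simp [symBasis]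
      · rw [if_neg hc, if_neg fun h => hc (Idx.bar_injective h).symm, zero_smul, smul_zero]
    · by_cases hc : c = a.bar
      · subst hc; simp [symBasis, Idx.bar_bar]
      · rw [if_neg hc, if_neg fun h => hc (by rw [h, Idx.bar_bar]), zero_smul, smul_zero]
  rw [symBasis.eq_def c d, lie_symProd, h, symProd_comm c.vec, h, symBasis_comm a c,
    symBasis_comm o.bar c]

theorem gen_zero_pairProd_comm {n k l : ℕ} (o a : Idx n) (d : Fin l → ℤ)
    (w : Fin l × Bool → Idx n) :
    gen k (symBasis a o.bar) 0 * pairProd k d w - pairProd k d w * gen k (symBasis a o.bar) 0 =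
      o.sign • (∑ s, if w s = o then pairProd k d (Function.update w s a) else 0) +
      a.bar.sign • (∑ s, if w s = a.bar then pairProd k d (Function.update w s o.bar) else 0) := by
  rw [pairProd, mul_ofFn_prod_sub, Fintype.sum_prod_type, Fintype.sum_prod_type, Finset.smul_sum,
    Finset.smul_sum, ← Finset.sum_add_distrib]
  refine Finset.sum_congr rfl fun t _ => ?_
  simp only [Fintype.sum_bool, pairProd_update_false, pairProd_update_true]
  simp only [← MultilinearMap.mkPiAlgebraFin_apply (R := ℂ)]
  rw [gen_zero_comm, lie_symBasis]
  have hg : ∀ (P : Prop) [Decidable P] (r : ℂ) (x : SpAlg n),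
      gen k (if P then r • x else 0) (d t) = if P then r • gen k x (d t) else 0 := by
    intro P _ r x
    split_ifs
    · exact gen_smul k r x _
    · exact gen_zero k _
  have hm : ∀ (P : Prop) [Decidable P] (r : ℂ) (f : Fin l → LevelAlg n k) (x : LevelAlg n k),
      MultilinearMap.mkPiAlgebraFin ℂ l (LevelAlg n k)
        (Function.update f t (if P then r • x else 0)) =
      r • if P then MultilinearMap.mkPiAlgebraFin ℂ l (LevelAlg n k) (Function.update f t x)
        else 0 := by
    intro P _ r f x
    split_ifs
    · exact MultilinearMap.map_update_smul _ _ _ _ _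
    · rw [smul_zero]; exact MultilinearMap.map_update_zero _ _ _
  simp only [gen_add, hg, MultilinearMap.map_update_add, hm, smul_add]
  abel

/-- The symmetrized product: the sum of the products labelled by all words with given multiset of
indices, where the degrees are in ascending order. -/
def symFamily {n : ℕ} (k : ℕ) {l : ℕ} (c : Multiset (Idx n)) (i : Fin l → ℤ) : LevelAlg n k :=
  ∑ w : Fin l × Bool → Idx n with Finset.univ.val.map w = c, pairProd k (i ∘ Tuple.sort i) w

theorem gen_zero_symFamily_comm {n k l : ℕ} (o a : Idx n) (c : Multiset (Idx n))
    (i : Fin l → ℤ) :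
    gen k (symBasis a o.bar) 0 * symFamily k c i - symFamily k c i * gen k (symBasis a o.bar) 0 =
      o.sign • (if o ∈ c then (a ::ₘ c.erase o).count a • symFamily k (a ::ₘ c.erase o) i else 0) +
      a.bar.sign • (if a.bar ∈ c then (o.bar ::ₘ c.erase a.bar).count o.bar •
        symFamily k (o.bar ::ₘ c.erase a.bar) i else 0) := by
  simp only [symFamily]
  rw [← sum_update_eq, ← sum_update_eq, Finset.mul_sum, Finset.sum_mul, ← Finset.sum_sub_distrib,
    Finset.smul_sum, Finset.smul_sum, ← Finset.sum_add_distrib]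
  exact Finset.sum_congr rfl fun w _ => gen_zero_pairProd_comm o a _ w

theorem symFamily_replicate {n k l : ℕ} (o : Idx n) (i : Fin l → ℤ) :
    symFamily k (Multiset.replicate (2 * l) o) i =
      (List.ofFn fun t => gen k (symBasis o o) ((i ∘ Tuple.sort i) t)).prod := by
  rw [symFamily, Finset.sum_eq_single_of_mem (fun _ => o)]
  · rfl
  · rw [Finset.mem_filter, Multiset.map_const']
    refine ⟨Finset.mem_univ _, ?_⟩
    congr 1
    simp [mul_comm]
  · intro w hw hne
    exfalso
    apply hne
    funext s
    have h := (Finset.mem_filter.1 hw).2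
    exact Multiset.eq_of_mem_replicate (h ▸ Multiset.mem_map_of_mem w (Finset.mem_univ s))

/-! ### Vertex operators of the relations -/

open Filter Topology

instance (n k : ℕ) : NonarchimedeanRing (LevelAlg n k) := (leftIdeal_basis n k).nonarchimedean

theorem leftIdeal_hasBasis (n k : ℕ) :
    (𝓝 (0 : LevelAlg n k)).HasBasis (fun _ : ℕ => True) fun N => (leftIdeal n k N : Set _) :=
  (leftIdeal_basis n k).hasBasis_nhds_zero

theorem summable_coe {n k : ℕ} {ι : Type*} {f : ι → LevelAlg n k}
    (h : ∀ N : ℕ, {i | f i ∉ leftIdeal n k N}.Finite) :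
    Summable fun i => (f i : CompletedAlg n k) := by
  apply NonarchimedeanAddGroup.summable_of_tendsto_cofinite_zero
  have h1 : Tendsto f cofinite (𝓝 0) := by
    rw [(leftIdeal_hasBasis n k).tendsto_right_iff]
    intro N _
    exact h N
  have h2 := ((UniformSpace.Completion.continuous_coe (LevelAlg n k)).tendsto 0).comp h1
  rwa [UniformSpace.Completion.coe_zero] at h2

/-- The tuples of given sum. -/
abbrev SumTuple (l : ℕ) (M : ℤ) : Type := {i : Fin l → ℤ // ∑ t, i t = M}

/-- An upper bound on all entries, together with the fixed sum, bounds each entry from below. -/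
theorem finite_sumTuple_lt (l : ℕ) (M N : ℤ) :
    {i : SumTuple l M | ∀ t, i.1 t < N}.Finite := by
  refine Set.Finite.of_finite_image (f := Subtype.val) ?_ Subtype.val_injective.injOn
  refine (Set.finite_Icc (fun _ : Fin l => M - l * |N|) (fun _ => N)).subset ?_
  rintro _ ⟨⟨i, hi⟩, hlt, rfl⟩
  refine ⟨fun t => ?_, fun t => (hlt t).le⟩
  simp only
  have h1 : ∑ s ∈ Finset.univ.erase t, i s ≤ ∑ s ∈ Finset.univ.erase t, |N| :=
    Finset.sum_le_sum fun s _ => (hlt s).le.trans (le_abs_self N)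
  have h2 := Finset.add_sum_erase Finset.univ i (Finset.mem_univ t)
  rw [hi] at h2
  rw [Finset.sum_const, Finset.card_erase_of_mem (Finset.mem_univ t), Finset.card_univ,
    Fintype.card_fin, nsmul_eq_mul] at h1
  have h3 : ((l - 1 : ℕ) : ℤ) * |N| ≤ l * |N| :=
    mul_le_mul_of_nonneg_right (by exact_mod_cast Nat.sub_le l 1) (abs_nonneg N)
  linarith

theorem list_prod_mem_of_mem {A : Type*} [Ring A] (I : Submodule A A) {L : List A} {x : A}
    (hx : x ∈ L) (hxI : x ∈ I) (hc : ∀ y ∈ L, ∀ z ∈ L, Commute y z) : L.prod ∈ I := by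
  induction L with
  | nil => simp at hx
  | cons y L ih =>
    rw [List.prod_cons]
    rcases List.mem_cons.1 hx with rfl | hx
    · have : Commute x L.prod := Commute.list_prod_right L x fun z hz =>
        hc _ List.mem_cons_self z (List.mem_cons_of_mem _ hz)
      rw [this.eq]
      exact I.smul_mem _ hxI
    · exact I.smul_mem _ (ih hx fun y hy z hz =>
        hc y (List.mem_cons_of_mem _ hy) z (List.mem_cons_of_mem _ hz))

section

variable {n k : ℕ}

theorem gen_mem_leftIdeal {N : ℕ} {i : ℤ} (h : (N : ℤ) ≤ i) (x : SpAlg n) :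
    gen k x i ∈ leftIdeal n k N := Submodule.subset_span ⟨x, i, h, rfl⟩

theorem gen_commute {x : SpAlg n} (hx : form n x x = 0) (i j : ℤ) :
    Commute (gen k x i) (gen k x j) := by
  have h := gen_comm k x x i j
  rw [lie_self, hx, gen_zero] at h
  simp only [mul_zero, ite_self, zero_mul, map_zero, add_zero] at h
  exact sub_eq_zero.1 h

/-- All but finitely many tuples have an entry of degree at least N, and commutativity lets that
factor move to the right end, into the left ideal. -/
theorem summable_genProd {x : SpAlg n} (hx : form n x x = 0) (l : ℕ) (M : ℤ) :
    Summable fun i : SumTuple l M =>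
      (((List.ofFn fun t => gen k x (i.1 t)).prod : LevelAlg n k) : CompletedAlg n k) := by
  refine summable_coe fun N => (finite_sumTuple_lt l M N).subset fun i hi t => ?_
  by_contra h
  refine hi (list_prod_mem_of_mem _ (List.mem_ofFn.2 ⟨t, rfl⟩)
    (gen_mem_leftIdeal (not_lt.1 h) x) fun y hy z hz => ?_)
  obtain ⟨s, rfl⟩ := List.mem_ofFn.1 hy
  obtain ⟨s', rfl⟩ := List.mem_ofFn.1 hz
  exact gen_commute hx _ _

/-- Splitting off the first entry of a tuple of given sum. -/
def sumTupleConsEquiv (l : ℕ) (M : ℤ) : (Σ q : ℤ, SumTuple l (M - q)) ≃ SumTuple (l + 1) M where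
  toFun i := ⟨Fin.cons i.1 i.2.1, by
    rw [Fin.sum_univ_succ]
    simp only [Fin.cons_zero, Fin.cons_succ, i.2.2, add_sub_cancel]⟩
  invFun i := ⟨i.1 0, Fin.tail i.1, by
    have := i.2
    rw [Fin.sum_univ_succ] at this
    simp only [Fin.tail]
    linarith⟩
  left_inv i := by
    obtain ⟨q, i, hi⟩ := i
    exact Sigma.ext rfl (heq_of_eq (Subtype.ext (funext fun _ => rfl)))
  right_inv i := Subtype.ext (Fin.cons_self_tail i.1)

/-- The coefficients of the normally ordered power `x(z)^l` of a field which commutes with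
itself. -/
theorem exists_isVertexOp_pow {x : SpAlg n} (hx : form n x x = 0) (l : ℕ) :
    ∃ V, IsVertexOp (gen k x (-1) ^ l • vac n k) V ∧ ∀ m : ℤ,
      HasSum (fun i : SumTuple l (m + 1 - l) =>
        (((List.ofFn fun t => gen k x (i.1 t)).prod : LevelAlg n k) : CompletedAlg n k)) (V m) := by
  induction l with
  | zero =>
    refine ⟨_, by rw [pow_zero, one_smul]; exact IsVertexOp.vacuum, fun m => ?_⟩
    by_cases hm : m = -1
    · subst hm
      have : Unique (SumTuple 0 (-1 + 1 - (0 : ℕ))) :=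
        { default := ⟨Fin.elim0, by simp⟩, uniq := fun i => Subtype.ext (Subsingleton.elim _ _) }
      have h := hasSum_unique fun i : SumTuple 0 (-1 + 1 - (0 : ℕ)) =>
        (((List.ofFn fun t => gen k x (i.1 t)).prod : LevelAlg n k) : CompletedAlg n k)
      simpa [UniformSpace.Completion.coe_one] using h
    · have : IsEmpty (SumTuple 0 (m + 1 - (0 : ℕ))) := ⟨fun i => hm (by
        have := i.2
        simp at this
        omega)⟩
      simp only [if_neg hm]
      exact hasSum_empty
  | succ l ih =>
    obtain ⟨V, hV, hsum⟩ := ih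
    refine ⟨fun m => ∑' i : SumTuple (l + 1) (m + 1 - (l + 1 : ℕ)),
      (((List.ofFn fun t => gen k x (i.1 t)).prod : LevelAlg n k) : CompletedAlg n k), ?_,
      fun m => (summable_genProd hx (l + 1) _).hasSum⟩
    rw [pow_succ', mul_smul]
    refine IsVertexOp.lie x (-1) _ V _ hV fun m => ?_
    have hcomm : ∀ m i : ℤ, V m * cgen k x i = cgen k x i * V m := by
      intro m i
      refine HasSum.unique ((hsum m).mul_right (cgen k x i)) ?_
      convert (hsum m).mul_left (cgen k x i) using 2 with s
      rw [cgen, ← UniformSpace.Completion.coe_mul, ← UniformSpace.Completion.coe_mul]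
      congr 1
      refine (Commute.list_prod_right _ _ fun z hz => ?_).eq.symm
      obtain ⟨t, rfl⟩ := List.mem_ofFn.1 hz
      exact gen_commute hx _ _
    have h1 := (sumTupleConsEquiv l (m + 1 - (l + 1 : ℕ))).hasSum_iff.2
      (summable_genProd (k := k) hx (l + 1) (m + 1 - (l + 1 : ℕ))).hasSum
    have h2 := HasSum.sigma (g := fun q => cgen k x q * V (m - 1 - q)) h1 (by
      intro q
      have he : m + 1 - (l + 1 : ℕ) - q = (m - 1 - q) + 1 - l := by push_cast; ring
      have h3 := (hsum (m - 1 - q)).mul_left (cgen k x q)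
      rw [← he] at h3
      refine (congrArg (fun f => HasSum f _) (funext fun i => ?_)).mpr h3
      change _ = ((gen k x q : LevelAlg n k) : CompletedAlg n k) * _
      rw [← UniformSpace.Completion.coe_mul]
      simp [sumTupleConsEquiv, List.ofFn_succ])
    -- The sum over all q ∈ ℤ is folded at zero: q = i ≥ 0 gives the factors x(i) of the vertex
    -- operator formula and q = -1 - i gives x(-1-i). For p = -1 all its coefficients (-1)^i (p
    -- choose i) equal 1.
    have h3 := h2.nat_add_neg_add_one
    convert h3 using 2 with i
    have hch : ((-1) ^ i * Ring.choose (-1) i : ℤ) = 1 := by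
      rw [Ring.choose_neg, add_sub_cancel_left, Ring.choose_natCast, Nat.choose_self]
      rcases Nat.even_or_odd i with h | h
      · simp [h.neg_one_pow, Int.negOnePow_even (i : ℤ) (by exact_mod_cast h)]
      · simp [h.neg_one_pow, Int.negOnePow_odd (i : ℤ) (by exact_mod_cast h), Units.smul_def]
    have hneg : ((Int.negOnePow (-1) : ℤˣ) : ℤ) = -1 := by simp
    rw [hch, one_smul, hneg, neg_smul, one_smul, sub_neg_eq_add, hcomm, add_comm]
    congr 3 <;> ring

/-- The family `T` describes the coefficients of the vertex operator of some element of `R`. -/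
def IsRelFamily (xθ : SpAlg n) (T : (Fin (k + 1) → ℤ) → LevelAlg n k) : Prop :=
  ∃ r ∈ relModule k xθ, ∃ V, IsVertexOp r V ∧ ∀ m : ℤ,
    HasSum (fun i : SumTuple (k + 1) (m + 1 - (k + 1 : ℕ)) => (T i.1 : CompletedAlg n k)) (V m)

theorem IsRelFamily.add {xθ : SpAlg n} {T T' : (Fin (k + 1) → ℤ) → LevelAlg n k}
    (h : IsRelFamily xθ T) (h' : IsRelFamily xθ T') : IsRelFamily xθ (fun i => T i + T' i) := by
  obtain ⟨_, ⟨u, rfl⟩, V, hV, hs⟩ := h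
  obtain ⟨_, ⟨u', rfl⟩, V', hV', hs'⟩ := h'
  refine ⟨_, ⟨u + u', rfl⟩, V + V', ?_, fun m => ?_⟩
  · rw [map_add, add_smul]
    exact hV.add _ _ _ _ hV'
  · simp only [UniformSpace.Completion.coe_add]
    exact (hs m).add (hs' m)

theorem IsRelFamily.smul {xθ : SpAlg n} {T : (Fin (k + 1) → ℤ) → LevelAlg n k}
    (h : IsRelFamily xθ T) (c : ℂ) : IsRelFamily xθ (fun i => c • T i) := by
  obtain ⟨_, ⟨u, rfl⟩, V, hV, hs⟩ := h
  refine ⟨_, ⟨c • u, rfl⟩, c • V, ?_, fun m => ?_⟩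
  · rw [map_smul, smul_assoc]
    exact hV.smul c _ _
  · simp only [UniformSpace.Completion.coe_smul]
    exact (hs m).const_smul c

/-- For p = 0 only the term i = 0 of the vertex operator formula survives, so (y(0)v)_m = [y(0),
v_m]. -/
theorem IsRelFamily.comm {xθ : SpAlg n} {T : (Fin (k + 1) → ℤ) → LevelAlg n k}
    (h : IsRelFamily xθ T) (y : SpAlg n) :
    IsRelFamily xθ (fun i => gen k y 0 * T i - T i * gen k y 0) := by
  obtain ⟨_, ⟨u, rfl⟩, V, hV, hs⟩ := h
  refine ⟨gen k y 0 • _, ⟨UniversalEnvelopingAlgebra.ι ℂ y * u, ?_⟩,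
    fun m => cgen k y 0 * V m - V m * cgen k y 0, IsVertexOp.lie y 0 _ V _ hV fun m => ?_,
    fun m => ?_⟩
  · rw [map_mul, UniversalEnvelopingAlgebra.lift_ι_apply, mul_smul]
    rfl
  · have := hasSum_single (f := fun i : ℕ => ((-1) ^ i * Ring.choose (0 : ℤ) i : ℤ) •
        (cgen k y (0 - i) * V (m + i) -
          (Int.negOnePow 0 : ℤ) • (V (0 + m - i) * cgen k y i))) 0 (by
      intro i hi
      rw [Ring.choose_zero_pos ℤ (Nat.pos_of_ne_zero hi), mul_zero, zero_smul])
    simpa using this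
  · simp only [UniformSpace.Completion.coe_sub, UniformSpace.Completion.coe_mul]
    exact ((hs m).mul_left _).sub ((hs m).mul_right _)

/-- Invariance gives ⟨[h, x], x⟩ = 0. Hence the modes of a root vector commute with each other. -/
theorem form_self_eq_zero {h x : SpAlg n} {c : ℂ} (hc : c ≠ 0) (hx : ⁅h, x⁆ = c • x) :
    form n x x = 0 := by
  have h1 : form n ⁅h, x⁆ x = 0 := by
    rw [form_apply]
    have : (⁅h, x⁆ : SpAlg n).val = h.val * x.val - x.val * h.val := rfl
    rw [this, sub_mul, Matrix.trace_sub, Matrix.mul_assoc x.val, Matrix.trace_mul_comm x.val,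
      sub_self]
  rw [hx, map_smul, LinearMap.smul_apply, smul_eq_mul] at h1
  exact (mul_eq_zero.1 h1).resolve_left hc

theorem isRelFamily_base {xθ : SpAlg n} (hx : form n xθ xθ = 0) :
    IsRelFamily xθ fun i : Fin (k + 1) → ℤ =>
      (List.ofFn fun t => gen k xθ ((i ∘ Tuple.sort i) t)).prod := by
  obtain ⟨V, hV, hs⟩ := exists_isVertexOp_pow (k := k) hx (k + 1)
  refine ⟨_, ⟨1, rfl⟩, V, ?_, fun m => ?_⟩
  · rw [map_one, one_smul]
    exact hV
  · convert hs m using 3 with i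
    refine List.Perm.prod_eq' ?_ ?_
    · exact Equiv.Perm.ofFn_comp_perm (Tuple.sort i.1) fun t => gen k xθ (i.1 t)
    · refine List.pairwise_iff_forall_sublist.2 fun {y z} h => ?_
      obtain ⟨s, rfl⟩ := List.mem_ofFn.1 (h.subset (by simp : y ∈ [y, z]))
      obtain ⟨t, rfl⟩ := List.mem_ofFn.1 (h.subset (by simp : z ∈ [_, z]))
      exact gen_commute hx _ _

/-- Polarization of the power of x_θ, by induction on the number of indices in the content other
than o. -/
theorem isRelFamily_symFamily {xθ : SpAlg n} {o : Idx n} {γ : ℂ} (hγ : symBasis o o = γ • xθ)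
    (hx : form n xθ xθ = 0) (c : Multiset (Idx n)) (hc : c.card = 2 * (k + 1)) :
    IsRelFamily xθ (symFamily (l := k + 1) k c) := by
  obtain ⟨m, hm⟩ : ∃ m, m + c.count o = 2 * (k + 1) :=
    ⟨_, Nat.sub_add_cancel (hc ▸ Multiset.count_le_card o c)⟩
  induction m using Nat.strong_induction_on generalizing c with
  | _ m ih =>
  by_cases hall : ∀ a ∈ c, a = o
  · rw [Multiset.eq_replicate.2 ⟨hc, hall⟩]
    convert (isRelFamily_base (k := k) hx).smul (γ ^ (k + 1)) using 2 with i
    rw [symFamily_replicate, hγ]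
    simp only [gen_smul]
    simp only [← MultilinearMap.mkPiAlgebraFin_apply (R := ℂ)]
    rw [MultilinearMap.map_smul_univ]
    simp
  · push Not at hall
    obtain ⟨a, hac, hao⟩ := hall
    -- The content with one `a` turned into `o` is covered by induction. Commuting with e_a e_{o̲}
    -- turns an `o` back into `a` and returns `c` with multiplicity `c.count a`, plus one further
    -- term.
    set c₀ := o ::ₘ c.erase a with hc₀
    have hcount : c₀.count o = c.count o + 1 := by
      rw [hc₀, Multiset.count_cons_self, Multiset.count_erase_of_ne hao.symm]
    have hcard : c₀.card = 2 * (k + 1) := by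
      rw [hc₀, Multiset.card_cons, Multiset.card_erase_of_mem hac, ← hc]
      have := Multiset.card_pos_iff_exists_mem.2 ⟨a, hac⟩
      exact Nat.succ_pred_eq_of_pos this
    have hle : c₀.count o ≤ 2 * (k + 1) := hcard ▸ Multiset.count_le_card o c₀
    have h0 := (ih (m - 1) (by omega) c₀ hcard (by omega)).comm (symBasis a o.bar)
    simp only [gen_zero_symFamily_comm o a c₀] at h0
    have hoc : o ∈ c₀ := Multiset.mem_cons_self o _
    have hback : a ::ₘ c₀.erase o = c := by
      rw [hc₀, Multiset.erase_cons_head, Multiset.cons_erase hac]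
    simp only [if_pos hoc, hback] at h0
    have hca : (c.count a : ℂ) ≠ 0 := by
      exact_mod_cast (Multiset.count_pos.2 hac).ne'
    -- Here the two replacements made by the commutator coincide and carry the same sign, so they
    -- double instead of cancelling.
    by_cases hab : a = o.bar
    · subst hab
      rw [Idx.bar_bar] at h0
      simp only [if_pos hoc, hback] at h0
      convert h0.smul (2 * o.sign * c.count o.bar)⁻¹ using 2 with i
      rw [← two_smul ℂ, smul_smul, ← Nat.cast_smul_eq_nsmul ℂ, smul_smul, smul_smul,
        mul_assoc, mul_assoc, ← mul_assoc (2 : ℂ),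
        inv_mul_cancel₀ (mul_ne_zero (mul_ne_zero two_ne_zero o.sign_ne_zero) hca), one_smul]
    · have habo : a.bar ≠ o := fun h => hab (by rw [← h, Idx.bar_bar])
      have h1 : IsRelFamily xθ fun i => (o.sign * c.count a) • symFamily (l := k + 1) k c i := by
        by_cases hb : a.bar ∈ c₀
        · simp only [if_pos hb] at h0
          -- The further term replaces a̲ by o̲. Neither is `o`, so it has as many `o` as `c₀` and
          -- is subtracted by induction.
          set c₁ := o.bar ::ₘ c₀.erase a.bar with hc₁
          have hcount₁ : c₁.count o = c₀.count o := by
            rw [hc₁, Multiset.count_cons_of_ne o.bar_ne.symm, Multiset.count_erase_of_ne habo.symm]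
          have hcard₁ : c₁.card = 2 * (k + 1) := by
            rw [hc₁, Multiset.card_cons, Multiset.card_erase_of_mem hb, ← hcard]
            exact Nat.succ_pred_eq_of_pos (Multiset.card_pos_iff_exists_mem.2 ⟨_, hb⟩)
          have h2 := (ih (m - 1) (by omega) c₁ hcard₁ (by omega)).smul
            (-(a.bar.sign * c₁.count o.bar))
          convert h0.add h2 using 2 with i
          rw [neg_smul, ← Nat.cast_smul_eq_nsmul ℂ, ← Nat.cast_smul_eq_nsmul ℂ, smul_smul,
            smul_smul, add_neg_cancel_right]
        · simp only [if_neg hb, smul_zero, add_zero] at h0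
          convert h0 using 2 with i
          rw [← Nat.cast_smul_eq_nsmul ℂ, smul_smul]
      convert h1.smul (o.sign * c.count a)⁻¹ using 2 with i
      rw [smul_smul, inv_mul_cancel₀ (mul_ne_zero o.sign_ne_zero hca), one_smul]

end

/-! ### Leading terms of convergent sums -/

theorem exists_linearCombination_of_mem {n k l : ℕ} {N : ℤ} {X : Place n → SpAlg n}
    {u : LevelAlg n k} (hu : u ∈ monomialSpan k X l N) :
    ∃ ν : ColPart n →₀ ℂ, Finsupp.linearCombination ℂ (monomial k X) ν = u ∧
      ∀ Ψ, ν Ψ ≠ 0 → Ψ.card ≤ l ∧ (0 ≤ N → ∃ q ∈ Ψ, N ≤ (ofLex q).1) := by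
  have h : monomialSpan k X l N = Submodule.span ℂ (monomial k X ''
      {Ψ | Ψ.card ≤ l ∧ (0 ≤ N → ∃ q ∈ Ψ, N ≤ (ofLex q).1)}) := by
    rw [monomialSpan]
    congr 1
    ext u
    constructor
    · rintro ⟨Ψ, h1, h2, rfl⟩
      exact ⟨Ψ, ⟨h1, h2⟩, rfl⟩
    · rintro ⟨Ψ, ⟨h1, h2⟩, rfl⟩
      exact ⟨Ψ, h1, h2, rfl⟩
  rw [h, Finsupp.mem_span_image_iff_linearCombination] at hu
  obtain ⟨ν, hν, rfl⟩ := hu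
  exact ⟨ν, rfl, fun Ψ hΨ => (Finsupp.mem_supported ℂ ν).1 hν (Finsupp.mem_support_iff.2 hΨ)⟩

theorem ColPart.exists_degree_lt {n : ℕ} (Ψ : ColPart n) : ∃ N : ℕ, ∀ q ∈ Ψ, (ofLex q).1 < N := by
  induction Ψ using Multiset.induction_on with
  | empty => exact ⟨0, by simp⟩
  | cons q Ψ ih =>
    obtain ⟨N, hN⟩ := ih
    refine ⟨max N ((ofLex q).1.toNat + 1), fun x hx => ?_⟩
    rcases Multiset.mem_cons.1 hx with rfl | hx
    · have := Int.self_le_toNat (ofLex x).1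
      push_cast
      exact lt_max_of_lt_right (by omega)
    · have := hN x hx
      push_cast
      exact lt_max_of_lt_left this

/-- The terms indexed by pairs (i, Ψ) are summable because Ψ must contain a part of degree at least
`N i` when this is nonnegative. They can thus be summed over i first or over Ψ first. The common
factor `g` with natural multiplicities rules out cancellation at Φ. -/
theorem isLeadingTerm_of_hasSum {n k : ℕ} {X : Place n → SpAlg n} {ι : Type*}
    {ρ : CompletedAlg n k} {Φ : ColPart n} (ν : ι → ColPart n →₀ ℂ) (N : ι → ℤ)
    (hs : HasSum (fun i => ((Finsupp.linearCombination ℂ (monomial k X) (ν i) : LevelAlg n k) :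
      CompletedAlg n k)) ρ)
    (hfin : ∀ N₀ : ℕ, {i | N i < N₀}.Finite)
    (hN : ∀ i Ψ, ν i Ψ ≠ 0 → 0 ≤ N i → ∃ q ∈ Ψ, N i ≤ (ofLex q).1)
    (hlead : ∀ i Ψ, ν i Ψ ≠ 0 → Ψ = Φ ∨ ColPart.Prec Φ Ψ)
    {g : ℂ} (hg : g ≠ 0) (c : ι → ℕ) (hc : ∀ i, ν i Φ = c i * g) (hpos : ∃ i, c i ≠ 0) :
    IsLeadingTerm X ρ Φ := by
  classical
  have hsum : Summable fun x : ι × ColPart n =>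
      ((ν x.1 x.2 • monomial k X x.2 : LevelAlg n k) : CompletedAlg n k) := by
    refine summable_coe fun N₀ => ?_
    refine ((hfin N₀).biUnion fun i _ =>
      ((ν i).support.finite_toSet.image fun Ψ => (i, Ψ))).subset ?_
    rintro ⟨i, Ψ⟩ hx
    have h0 : ν i Ψ ≠ 0 := by
      rintro h0
      apply hx
      simp only [h0, zero_smul]
      exact zero_mem _
    simp only [Set.mem_iUnion, Set.mem_image, Set.mem_ofPred_eq]
    refine ⟨i, ?_, Ψ, Finsupp.mem_support_iff.2 h0, rfl⟩
    by_contra hi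
    apply hx
    obtain ⟨q, hq, hqN⟩ := hN i Ψ h0 (by omega)
    simp only
    rw [Algebra.smul_def]
    exact (leftIdeal n k N₀).smul_mem _ (monomial_mem_leftIdeal ⟨q, hq, by omega⟩)
  have hfib : ∀ i, HasSum (fun Ψ => ((ν i Ψ • monomial k X Ψ : LevelAlg n k) : CompletedAlg n k))
      ((Finsupp.linearCombination ℂ (monomial k X) (ν i) : LevelAlg n k) : CompletedAlg n k) := by
    intro i
    have h := hasSum_sum_of_ne_finset_zero (L := .unconditional _) (f := fun Ψ => ν i Ψ • monomial k X Ψ)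
      (s := (ν i).support) (by
        intro Ψ hΨ
        rw [Finsupp.notMem_support_iff.1 hΨ, zero_smul])
    exact h.map (UniformSpace.Completion.toCompl (α := LevelAlg n k))
      UniformSpace.Completion.continuous_toCompl
  have hρ := hsum.hasSum
  rw [(hρ.prod_fiberwise hfib).unique hs] at hρ
  -- The degrees in a fixed Ψ are bounded, so it can occur only for the finitely many i with `N i`
  -- below that bound.
  have hsupp : ∀ Ψ, {i | ν i Ψ ≠ 0}.Finite := by
    intro Ψ
    obtain ⟨N₀, hN₀⟩ := Ψ.exists_degree_lt
    refine (hfin N₀).subset fun i hi => ?_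
    by_contra h
    simp only [Set.mem_ofPred_eq, not_lt] at h
    obtain ⟨q, hq, hqN⟩ := hN i Ψ hi (by omega)
    have := hN₀ q hq
    omega
  refine ⟨fun Ψ => ∑ i ∈ (hsupp Ψ).toFinset, ν i Ψ, ?_, ?_, ?_⟩
  · refine HasSum.prod_fiberwise ((Equiv.prodComm (ColPart n) ι).hasSum_iff.2 hρ) fun Ψ => ?_
    have h := hasSum_sum_of_ne_finset_zero (L := .unconditional _) (f := fun i => ν i Ψ • monomial k X Ψ)
      (s := (hsupp Ψ).toFinset) (by
        intro i hi
        simp only [Set.Finite.mem_toFinset, Set.mem_ofPred_eq, not_not] at hi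
        rw [hi, zero_smul])
    rw [← Finset.sum_smul] at h
    exact h.map (UniformSpace.Completion.toCompl (α := LevelAlg n k))
      UniformSpace.Completion.continuous_toCompl
  · beta_reduce
    rw [Finset.sum_congr rfl fun i _ => hc i, ← Finset.sum_mul]
    refine mul_ne_zero ?_ hg
    obtain ⟨i, hi⟩ := hpos
    have hmem : i ∈ (hsupp Φ).toFinset := by
      simp only [Set.Finite.mem_toFinset, Set.mem_ofPred_eq, hc]
      exact mul_ne_zero (by exact_mod_cast hi) hg
    have h1 := Finset.single_le_sum (f := c) (fun _ _ => Nat.zero_le _) hmem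
    have h2 : ∑ i ∈ (hsupp Φ).toFinset, c i ≠ 0 := by omega
    exact_mod_cast h2
  · intro Ψ hΨ
    obtain ⟨i, -, hi⟩ := Finset.exists_ne_zero_of_sum_ne_zero hΨ
    exact hlead i Ψ hi

/-! ### Leading terms of symmetrized products -/

/-- The place with the given pair of indices. -/
def Place.ofPair {n : ℕ} (a b : Idx n) : Place n := ⟨max a b, min a b, min_le_max⟩

theorem symBasis_ofPair {n : ℕ} (a b : Idx n) :
    symBasis (Place.ofPair a b).col (Place.ofPair a b).row = symBasis a b := by
  rcases le_total a b with h | h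
  · rw [symBasis_comm a b]
    simp [Place.ofPair, h]
  · simp [Place.ofPair, h]

theorem Place.ofPair_col_row {n : ℕ} (p : Place n) : Place.ofPair p.col p.row = p := by
  have := p.row_le_col
  ext <;> simp [Place.ofPair, this]

/-- The places of the consecutive pairs of indices of a word. -/
def pairPlaces {n l : ℕ} (w : Fin l × Bool → Idx n) (t : Fin l) : Place n :=
  Place.ofPair (w (t, false)) (w (t, true))

theorem content_ofFun_pairPlaces {n l : ℕ} (d : Fin l → ℤ) (w : Fin l × Bool → Idx n) :
    (ColPart.ofFun d (pairPlaces w)).content = Finset.univ.val.map w := by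
  have h : ∀ a b : Idx n, ({max a b} : Multiset (Idx n)) + {min a b} = {a} + {b} := by
    intro a b
    rcases le_total a b with h | h
    · rw [max_eq_right h, min_eq_left h, add_comm]
    · rw [max_eq_left h, min_eq_right h]
  have hl : (ColPart.ofFun d (pairPlaces w)).content =
      ∑ t, (({w (t, false)} : Multiset (Idx n)) + {w (t, true)}) := by
    rw [ColPart.content, ColPart.ofFun, Multiset.map_map, Multiset.map_map]
    rw [← Finset.sum_congr rfl fun t _ => h (w (t, false)) (w (t, true)),
      Finset.sum_add_distrib]
    congr 1 <;> exact (Multiset.sum_map_singleton _).symm.trans (by rw [Multiset.map_map]; rfl)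
  rw [hl]
  have hr : (Finset.univ.val.map w : Multiset (Idx n)) =
      ∑ s : Fin l × Bool, ({w s} : Multiset (Idx n)) :=
    (Multiset.sum_map_singleton _).symm.trans (by rw [Multiset.map_map]; rfl)
  rw [hr, Fintype.sum_prod_type]
  simp only [Fintype.sum_bool]
  exact Finset.sum_congr rfl fun t _ => add_comm _ _

theorem pairProd_eq_sum {n k l : ℕ} {X : Place n → SpAlg n} {γ : Place n → Place n → ℂ}
    (hγ : ∀ p, symBasis p.col p.row = ∑ q, γ p q • X q) (d : Fin l → ℤ)
    (w : Fin l × Bool → Idx n) :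
    pairProd k d w = ∑ q : Fin l → Place n, (∏ t, γ (pairPlaces w t) (q t)) •
      wordProd k X (List.ofFn fun t => part (d t) (q t)) := by
  have h1 : pairProd k d w = MultilinearMap.mkPiAlgebraFin ℂ l (LevelAlg n k)
      fun t => ∑ q, γ (pairPlaces w t) q • gen k (X q) (d t) := by
    rw [MultilinearMap.mkPiAlgebraFin_apply, pairProd]
    congr 2
    funext t
    rw [← symBasis_ofPair, hγ, gen_sum]
    simp only [gen_smul]
    rfl
  rw [h1, MultilinearMap.map_sum]
  refine Finset.sum_congr rfl fun q _ => ?_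
  rw [MultilinearMap.map_smul_univ, MultilinearMap.mkPiAlgebraFin_apply, wordProd, List.map_ofFn]
  rfl

theorem coe_ofFn_part {n l : ℕ} (d : Fin l → ℤ) (q : Fin l → Place n) :
    ((List.ofFn fun t => part (d t) (q t) : List (Part n)) : Multiset (Part n)) =
      ColPart.ofFun d q := by
  rw [ColPart.ofFun, List.ofFn_eq_map, ← Multiset.map_coe]
  rfl

theorem lastGE_ofFn {n k : ℕ} (d : Fin (k + 1) → ℤ) (q : Fin (k + 1) → Place n) :
    LastGE (d (Fin.last k)) (List.ofFn fun t => part (d t) (q t)) := by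
  intro _
  rw [List.ofFn_succ']
  exact ⟨_, _, List.concat_eq_append, le_rfl⟩

/-- The number `c` counts the words of the given content whose places, with the sorted degrees, form
Φ itself; the product of diagonal coefficients depends on Φ alone, not on the tuple of degrees. -/
theorem exists_expansion {n k : ℕ} {X : Place n → SpAlg n} (hX : IsTriangularBasis X)
    {γ : Place n → Place n → ℂ} (hγ1 : ∀ p q, γ p q ≠ 0 → p ≤ q)
    (hγ : ∀ p, symBasis p.col p.row = ∑ q, γ p q • X q) {Φ : ColPart n} (hΦ : Φ.IsNested) {e : ℤ}
    (he : ∀ x ∈ Φ, (ofLex x).1 = e ∨ (ofLex x).1 = e - 1) (hcard : Φ.card = k + 1)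
    (i : Fin (k + 1) → ℤ) (hi : ∑ t, i t = Φ.degree) :
    ∃ ν : ColPart n →₀ ℂ,
      Finsupp.linearCombination ℂ (monomial k X) ν = symFamily k Φ.content i ∧
      (∀ Ψ, ν Ψ ≠ 0 → 0 ≤ (i ∘ Tuple.sort i) (Fin.last k) →
        ∃ q ∈ Ψ, (i ∘ Tuple.sort i) (Fin.last k) ≤ (ofLex q).1) ∧
      (∀ Ψ, ν Ψ ≠ 0 → Ψ = Φ ∨ ColPart.Prec Φ Ψ) ∧
      ∃ c : ℕ, ν Φ = c * (Φ.map fun x => γ (ofLex x).2 (ofLex x).2).prod ∧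
        ∀ w : Fin (k + 1) × Bool → Idx n, Finset.univ.val.map w = Φ.content →
          ColPart.ofFun (i ∘ Tuple.sort i) (pairPlaces w) = Φ → c ≠ 0 := by
  classical
  set d := i ∘ Tuple.sort i with hd
  set W : Finset (Fin (k + 1) × Bool → Idx n) :=
    Finset.univ.filter fun w => Finset.univ.val.map w = Φ.content with hW
  have hdeg : Φ.degree = ∑ t, d t := by
    rw [← hi]
    exact (Equiv.sum_comp (Tuple.sort i) i).symm
  have hmain : ∀ w ∈ W, ∀ q : Fin (k + 1) → Place n, ∏ t, γ (pairPlaces w t) (q t) ≠ 0 →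
      (ColPart.ofFun d q = Φ → pairPlaces w = q) ∧
        (ColPart.ofFun d q = Φ ∨ ColPart.Prec Φ (ColPart.ofFun d q)) := by
    intro w hw q hq
    refine hΦ.ofFun_eq_or_prec he
      (fun t => hγ1 _ _ (Finset.prod_ne_zero_iff.1 hq t (Finset.mem_univ t))) hcard hdeg ?_
    rw [content_ofFun_pairPlaces, (Finset.mem_filter.1 hw).2]
  have hlow : ∑ w ∈ W, ∑ q : Fin (k + 1) → Place n, (∏ t, γ (pairPlaces w t) (q t)) •
      (wordProd k X (List.ofFn fun t => part (d t) (q t)) - monomial k X (ColPart.ofFun d q)) ∈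
      monomialSpan k X k (d (Fin.last k)) := by
    refine Submodule.sum_mem _ fun w _ => Submodule.sum_mem _ fun q _ =>
      Submodule.smul_mem _ _ ?_
    have := wordProd_sub_monomial_mem (k := k) hX _ (lastGE_ofFn d q)
    rwa [coe_ofFn_part, List.length_ofFn, Nat.add_sub_cancel] at this
  obtain ⟨ν, hν, hνs⟩ := exists_linearCombination_of_mem hlow
  set μ : ColPart n →₀ ℂ := ∑ w ∈ W, ∑ q : Fin (k + 1) → Place n,
    Finsupp.single (ColPart.ofFun d q) (∏ t, γ (pairPlaces w t) (q t)) with hμ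
  have hμapp : ∀ Ψ, μ Ψ = ∑ w ∈ W, ∑ q : Fin (k + 1) → Place n,
      if ColPart.ofFun d q = Ψ then ∏ t, γ (pairPlaces w t) (q t) else 0 := by
    intro Ψ
    simp only [hμ, Finsupp.finsetSum_apply, Finsupp.single_apply]
  have hμs : ∀ Ψ, μ Ψ ≠ 0 → ∃ w ∈ W, ∃ q, ColPart.ofFun d q = Ψ ∧
      ∏ t, γ (pairPlaces w t) (q t) ≠ 0 := by
    intro Ψ hΨ
    rw [hμapp] at hΨ
    obtain ⟨w, hw, h1⟩ := Finset.exists_ne_zero_of_sum_ne_zero hΨ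
    obtain ⟨q, -, h2⟩ := Finset.exists_ne_zero_of_sum_ne_zero h1
    by_cases hq : ColPart.ofFun d q = Ψ
    · exact ⟨w, hw, q, hq, by rwa [if_pos hq] at h2⟩
    · exact absurd (if_neg hq) h2
  have hor : ∀ Ψ, (μ + ν) Ψ ≠ 0 → μ Ψ ≠ 0 ∨ ν Ψ ≠ 0 := by
    intro Ψ h
    by_contra! h'
    exact h (by rw [Finsupp.add_apply, h'.1, h'.2, add_zero])
  refine ⟨μ + ν, ?_, ?_, ?_, ?_⟩
  · rw [map_add, hν, hμ]
    simp only [map_sum, Finsupp.linearCombination_single]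
    rw [← Finset.sum_add_distrib, symFamily]
    refine Finset.sum_congr rfl fun w _ => ?_
    rw [← Finset.sum_add_distrib, pairProd_eq_sum hγ]
    refine Finset.sum_congr rfl fun q _ => ?_
    rw [← smul_add, add_sub_cancel]
  · intro Ψ hΨ h0
    rcases hor Ψ hΨ with h | h
    · obtain ⟨w, -, q, rfl, -⟩ := hμs Ψ h
      exact ⟨part (d (Fin.last k)) (q (Fin.last k)),
        Multiset.mem_map_of_mem (fun t => part (d t) (q t))
          (Finset.mem_val.mpr (Finset.mem_univ (Fin.last k))), le_rfl⟩
    · exact (hνs Ψ h).2 h0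
  · intro Ψ hΨ
    rcases hor Ψ hΨ with h | h
    · obtain ⟨w, hw, q, rfl, hq⟩ := hμs Ψ h
      exact (hmain w hw q hq).2
    · refine Or.inr (Or.inl ?_)
      have := (hνs Ψ h).1
      omega
  -- The correction from reordering has length at most k, so it cannot touch Φ.
  · have hνΦ : ν Φ = 0 := by
      by_contra h
      have := (hνs Φ h).1
      omega
    refine ⟨∑ w ∈ W, ∑ q : Fin (k + 1) → Place n,
      if ColPart.ofFun d q = Φ ∧ pairPlaces w = q then 1 else 0, ?_, ?_⟩
    · rw [Finsupp.add_apply, hνΦ, add_zero, hμapp]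
      push_cast
      rw [Finset.sum_mul]
      refine Finset.sum_congr rfl fun w hw => ?_
      rw [Finset.sum_mul]
      refine Finset.sum_congr rfl fun q _ => ?_
      by_cases hq : ColPart.ofFun d q = Φ
      · by_cases hp : pairPlaces w = q
        · rw [if_pos hq, if_pos ⟨hq, hp⟩, one_mul, hp, ← hq, ColPart.ofFun, Multiset.map_map]
          rfl
        · rw [if_pos hq, if_neg fun h => hp h.2, zero_mul]
          by_contra h0
          exact hp ((hmain w hw q h0).1 hq)
      · rw [if_neg hq, if_neg fun h => hq h.1, zero_mul]
    · intro w hw hwΦ h0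
      have h1 := Finset.sum_eq_zero_iff.1 h0 w (Finset.mem_filter.2 ⟨Finset.mem_univ _, hw⟩)
      have h2 := Finset.sum_eq_zero_iff.1 h1 (pairPlaces w) (Finset.mem_univ _)
      rw [if_pos ⟨hwΦ, rfl⟩] at h2
      exact one_ne_zero h2

theorem exists_monotone_map_eq {α : Type*} [LinearOrder α] {l : ℕ} (S : Multiset α)
    (hS : S.card = l) : ∃ f : Fin l → α, Monotone f ∧ Finset.univ.val.map f = S := by
  subst hS
  have hl : (S.sort (· ≤ ·)).length = S.card := Multiset.length_sort _
  refine ⟨fun t => (S.sort (· ≤ ·)).get (t.cast hl.symm), fun s t hst => ?_, ?_⟩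
  · rcases hst.eq_or_lt with rfl | h
    · exact le_rfl
    · exact List.pairwise_iff_get.1 (Multiset.pairwise_sort S (· ≤ ·)) _ _ h
  · have h1 : (Finset.univ.val.map fun t : Fin S.card => (S.sort (· ≤ ·)).get (t.cast hl.symm)) =
        ((List.ofFn fun t : Fin S.card => (S.sort (· ≤ ·)).get (t.cast hl.symm) : List α) :
          Multiset α) := by
      rw [List.ofFn_eq_map, ← Multiset.map_coe]
      rfl
    rw [h1]
    conv_rhs => rw [← Multiset.sort_eq S (· ≤ ·)]
    congr 1
    refine List.ext_get (by simp) fun m h1 h2 => ?_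
    simp

/-- Every nested colored partition of length `k + 1` with at most two consecutive degrees is the
leading term of a coefficient of an annihilating field. -/
theorem ColPart.IsNested.exists_isLeadingTerm {n k : ℕ} (hn : 1 ≤ n) {X : Place n → SpAlg n}
    (hX : IsTriangularBasis X) {Φ : ColPart n} (hΦ : Φ.IsNested) {e : ℤ}
    (he : ∀ x ∈ Φ, (ofLex x).1 = e ∨ (ofLex x).1 = e - 1) (hcard : Φ.card = k + 1) :
    ∃ ρ ∈ relCoeffs k (X (Place.theta hn)), IsLeadingTerm X ρ Φ := by
  obtain ⟨γ, hγ0, hγ1, hγ⟩ := hX.exists_triangular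
  have hθ : (Place.theta hn).row ≠ (Place.theta hn).col.bar := (Idx.bar_ne _).symm
  have hform : form n (X (Place.theta hn)) (X (Place.theta hn)) = 0 := by
    refine form_self_eq_zero two_ne_zero
      ((hX.root_vector _ hθ (Pi.single ⟨0, hn⟩ 1)).trans ?_)
    simp only [Place.theta, Idx.weight, Pi.single_eq_same]
    norm_num
  obtain ⟨c₀, -, hc₀⟩ := hX.exists_symBasis_eq_smul hθ
  have hcc : Φ.content.card = 2 * (k + 1) := by
    rw [ColPart.content, Multiset.card_add, Multiset.card_map, Multiset.card_map, hcard, two_mul]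
  obtain ⟨r, hr, V, hV, hs⟩ := isRelFamily_symFamily (k := k) hc₀ hform Φ.content hcc
  -- The coefficient r_m is a sum over tuples of total m + 1 - (k + 1) = m - k, which must be the
  -- degree of Φ.
  set m : ℤ := Φ.degree + k with hm
  have hM : m + 1 - (k + 1 : ℕ) = Φ.degree := by push_cast; omega
  have hs := hs m
  rw [hM] at hs
  refine ⟨V m, ⟨r, hr, V, hV, m, rfl⟩, ?_⟩
  choose ν hν1 hν2 hν3 c hc hc0 using fun i : SumTuple (k + 1) Φ.degree =>
    exists_expansion hX hγ1 hγ hΦ he hcard i.1 i.2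
  refine isLeadingTerm_of_hasSum ν (fun i => (i.1 ∘ Tuple.sort i.1) (Fin.last k)) ?_ ?_ hν2 hν3
    (g := (Φ.map fun x => γ (ofLex x).2 (ofLex x).2).prod) ?_ c hc ?_
  · simpa only [hν1] using hs
  · intro N₀
    refine (finite_sumTuple_lt (k + 1) Φ.degree N₀).subset fun i hi t => ?_
    refine lt_of_le_of_lt ?_ hi
    have := Tuple.monotone_sort i.1 (Fin.le_last ((Tuple.sort i.1).symm t))
    simpa using this
  · refine Multiset.prod_ne_zero fun h => ?_
    obtain ⟨x, -, hx⟩ := Multiset.mem_map.1 h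
    exact hγ0 _ hx
  · obtain ⟨f, hf, hfΦ⟩ := exists_monotone_map_eq Φ hcard
    have hmono : Monotone fun t => (ofLex (f t)).1 := by
      intro s t hst
      rcases Prod.Lex.le_iff.1 (hf hst) with h | h
      · exact h.le
      · exact h.1.le
    -- The contributing word lists the columns and rows of the parts of Φ in ascending order; their
    -- degrees are already sorted.
    set w : Fin (k + 1) × Bool → Idx n := fun s =>
      if s.2 then (ofLex (f s.1)).2.row else (ofLex (f s.1)).2.col with hw
    have hp : pairPlaces w = fun t => (ofLex (f t)).2 := by
      funext t
      simp only [pairPlaces, hw, Bool.false_eq_true, if_false, if_true, Place.ofPair_col_row]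
    have hof : ColPart.ofFun (fun t => (ofLex (f t)).1) (pairPlaces w) = Φ := by
      rw [hp, ← hfΦ]
      rfl
    refine ⟨⟨fun t => (ofLex (f t)).1, ?_⟩, hc0 _ w ?_ ?_⟩
    · rw [← hof, ColPart.degree_ofFun]
    · rw [← content_ofFun_pairPlaces (fun t => (ofLex (f t)).1), hof]
    · have : Tuple.sort (fun t => (ofLex (f t)).1) = Equiv.refl _ :=
        Tuple.sort_eq_refl_iff_monotone.2 hmono
      simp only [this]
      exact hof

end AffineC

end

theorem theoremT (n : ℕ) (hn : 1 ≤ n) (k : ℕ) (hk : 1 ≤ k)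
    (X : AffineC.Place n → AffineC.SpAlg n) (hX : AffineC.IsTriangularBasis X)
    (j : ℤ) (a b : ℕ) (hab : a + b = k + 1) (r : AffineC.Idx n)
    (B A : List (AffineC.Place n)) (mB mA : AffineC.Place n → ℕ)
    (hB : AffineC.IsCascade B) (hA : AffineC.IsCascade A)
    (hBsum : (B.map mB).sum = b) (hAsum : (A.map mA).sum = a)
    (hBr : ∀ β ∈ B, mB β ≠ 0 → β ∈ AffineC.upperTriangle r)
    (hAr : ∀ α ∈ A, mA α ≠ 0 → α ∈ AffineC.lowerTriangle r) :
    ∃ ρ ∈ AffineC.relSpan k (X (AffineC.Place.theta hn)),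
      ρ ∈ AffineC.relCoeffs k (X (AffineC.Place.theta hn)) ∧
      AffineC.IsLeadingTerm X ρ
        (AffineC.cascadeMonomial (-j - 1) B mB + AffineC.cascadeMonomial (-j) A mA) := by
  obtain ⟨ρ, hρ, hlead⟩ := AffineC.ColPart.IsNested.exists_isLeadingTerm (k := k) hn hX
    (AffineC.isNested_cascadeMonomial (j := j) hB hA hBr hAr) (e := -j) (by
      intro x hx
      rw [Multiset.mem_add, AffineC.mem_cascadeMonomial, AffineC.mem_cascadeMonomial] at hx
      rcases hx with ⟨p, -, -, rfl⟩ | ⟨p, -, -, rfl⟩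
      · exact Or.inr rfl
      · exact Or.inl rfl) (by
      rw [Multiset.card_add, AffineC.card_cascadeMonomial, AffineC.card_cascadeMonomial, hBsum,
        hAsum, add_comm, hab])
  exact ⟨ρ, Submodule.subset_span hρ, hρ, hlead⟩
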